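/- Let $k>1$ and let $I=[0,1]$. Let $\eta\colon I\to SO_{2k}$ be a loop based at the identity that represents the generator of $\pi_1(SO_{2k})\cong\mathbb Z/2$, let $\gamma\colon I\to SO_{2k}$ be a path from $\mathbb 1$ to $-\mathbb 1$, and let $\eta*\gamma$ be the concatenation (first $\eta$, then $\gamma$). Let $X$ be a topological space (for example a CW-complex), let $SX$ be its unreduced suspension, obtained from $X\times I$ by collapsing $X\times\{0\}$ to one point and $X\times\{1\}$ to another, and write $[x,t]\in SX$ for the image of $(x,t)$. Let $g\colon X\to SO_{2k}$ be a continuous map; when $X$ is a CW-complex, such a map is the same thing as the clutching function of an oriented rank-$2k$ vector bundle $E\to SX$. For $\delta$ one of $\eta$, $\gamma$, $\eta*\gamma$ (a path between central elements of $SO_{2k}$) define the adjointed turning obstruction $$TO_\delta([g])=\bigl[\,[x,t]\mapsto g(x)\,\delta(t)\,g(x)^{-1}\,\bigr]\in[SX,SO_{2k}]$$ and the normalised turning obstruction $$\overline{to}_\delta([g])=\bigl[\,x\mapsto\bigl(t\mapsto g(x)\,\delta(t)\,g(x)^{-1}\delta(t)^{-1}\bigr)\bigr]\in[X,\Omega_0SO_{2k}].$$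 Here $[\cdot,\cdot]$ denotes free homotopy classes of continuous maps, $\Omega_0SO_{2k}$ is the space of null-homotopic loops based at $\mathbb 1$ with the compact-open topology, and both sets of homotopy classes carry the group structure, written additively, that is induced by pointwise multiplication in $SO_{2k}$. Then: 1. $2\,TO_\eta([g])=0$; 2. $TO_{\eta*\gamma}([g])=TO_\eta([g])+TO_\gamma([g])$; 3. if $k$ is even, then $2\,TO_\gamma([g])=0$; 4. if $k$ is odd, then $2\,TO_\gamma([g])=TO_\eta([g])$ and $4\,TO_\gamma([g])=0$. The same four statements hold with $\overline{to}$ in place of $TO$. -/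

import Mathlib

noncomputable section

namespace TurningObstruction

open Topology unitInterval

/-! ### Homotopy classes of maps -/

/-- `[X, Y]`: the set of (free) homotopy classes of continuous maps `X → Y`. -/
def HomotopyClasses (X Y : Type*) [TopologicalSpace X] [TopologicalSpace Y] :=
  Quotient (⟨ContinuousMap.Homotopic, ContinuousMap.Homotopic.equivalence⟩ : Setoid C(X, Y))

namespace HomotopyClasses

variable {X Y H : Type*} [TopologicalSpace X] [TopologicalSpace Y] [TopologicalSpace H]

/-- The homotopy class `[f]` of `f`. -/
def mk (f : C(X, Y)) : HomotopyClasses X Y := Quotient.mk _ f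

/-- Two maps have the same class iff they are homotopic. -/
theorem mk_eq_mk {f g : C(X, Y)} : mk f = mk g ↔ f.Homotopic g := Quotient.eq

/-- The map `[X, Y] → [X, H]` induced by a continuous map `Y → H`. -/
def postcomp (r : C(Y, H)) : HomotopyClasses X Y → HomotopyClasses X H :=
  Quotient.map (fun f => r.comp f) fun _ _ h => (ContinuousMap.Homotopic.refl r).comp h

variable [Group H] [IsTopologicalGroup H]

instance : Add (HomotopyClasses X H) where
  add := Quotient.map₂ (fun f g => f * g) fun _ _ ⟨F⟩ _ _ ⟨F'⟩ =>
    ⟨{ toFun := fun p => F p * F' p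
       map_zero_left := fun x => by simp
       map_one_left := fun x => by simp }⟩

instance : Zero (HomotopyClasses X H) where
  zero := mk 1

instance : Neg (HomotopyClasses X H) where
  neg := Quotient.map (fun f => f⁻¹) fun _ _ ⟨F⟩ =>
    ⟨{ toFun := fun p => (F p)⁻¹
       map_zero_left := fun x => by simp
       map_one_left := fun x => by simp }⟩

/-- For a topological group `H`, the set `[X, H]` is a group under pointwise multiplication
of representatives. It is written additively. -/
instance : AddGroup (HomotopyClasses X H) where
  add_assoc := by
    rintro ⟨f⟩ ⟨g⟩ ⟨h⟩
    exact congrArg mk (mul_assoc f g h)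
  zero_add := by
    rintro ⟨f⟩
    exact congrArg mk (one_mul f)
  add_zero := by
    rintro ⟨f⟩
    exact congrArg mk (mul_one f)
  neg_add_cancel := by
    rintro ⟨f⟩
    exact congrArg mk (inv_mul_cancel f)
  nsmul := nsmulRec
  zsmul := zsmulRec

theorem mk_add_mk (f g : C(X, H)) : mk f + mk g = mk (f * g) := rfl

theorem zero_def : (0 : HomotopyClasses X H) = mk 1 := rfl

end HomotopyClasses

/-! ### Suspensions -/

/-- The (unreduced) suspension `SX`: the quotient of `X × [0, 1]` in which `X × {0}` is collapsed
to one point and `X × {1}` is collapsed to another point. -/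
def Suspension (X : Type*) : Type _ :=
  Quot fun p q : X × I => (p.2 = 0 ∧ q.2 = 0) ∨ (p.2 = 1 ∧ q.2 = 1)

instance (X : Type*) [TopologicalSpace X] : TopologicalSpace (Suspension X) :=
  inferInstanceAs (TopologicalSpace (Quot _))

/-- The point `[x, t]` of `SX`. -/
def Suspension.mk {X : Type*} (p : X × I) : Suspension X := Quot.mk _ p

theorem Suspension.isQuotientMap_mk {X : Type*} [TopologicalSpace X] :
    IsQuotientMap (Suspension.mk : X × I → Suspension X) := isQuotientMap_quot_mk

/-! ### Spaces of paths -/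

section Paths

variable {G : Type*} [TopologicalSpace G]

/-- `Ω_γ G`: the space of paths in `G` that are homotopic to `γ` relative to the end points,
with the compact-open topology. -/
def PathClassSpace {a b : G} (γ : Path a b) := {δ : Path a b // δ.Homotopic γ}

instance {a b : G} (γ : Path a b) : TopologicalSpace (PathClassSpace γ) :=
  inferInstanceAs (TopologicalSpace {δ : Path a b // δ.Homotopic γ})

theorem PathClassSpace.continuous_eval {a b : G} (γ : Path a b) :
    Continuous fun p : PathClassSpace γ × I => p.1.1 p.2 :=
  Continuous.eval (continuous_subtype_val.comp continuous_fst) continuous_snd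

theorem PathClassSpace.continuous_mk {Y : Type*} [TopologicalSpace Y] {a b : G} (γ : Path a b)
    (f : Y → Path a b) (hf : Continuous fun p : Y × I => f p.1 p.2)
    (h : ∀ y, (f y).Homotopic γ) :
    Continuous (fun y => (⟨f y, h y⟩ : PathClassSpace γ)) :=
  Continuous.subtype_mk (Path.continuous_uncurry_iff.1 hf) h

variable {X : Type*} [TopologicalSpace X]

/-- The adjoint `[x, t] ↦ h x t` of a map `h : X → Ω_γ G`. -/
def adjointMap {a b : G} (γ : Path a b) (h : C(X, PathClassSpace γ)) : C(Suspension X, G) where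
  toFun := Quot.lift (fun p => (h p.1).1 p.2) (by
    rintro ⟨x, t⟩ ⟨y, s⟩ (⟨h1, h2⟩ | ⟨h1, h2⟩)
    · obtain rfl : t = 0 := h1
      obtain rfl : s = 0 := h2
      exact ((h x).1.source).trans ((h y).1.source).symm
    · obtain rfl : t = 1 := h1
      obtain rfl : s = 1 := h2
      exact ((h x).1.target).trans ((h y).1.target).symm)
  continuous_toFun := Suspension.isQuotientMap_mk.continuous_iff.2
    ((PathClassSpace.continuous_eval γ).comp (h.continuous.prodMap continuous_id))

/-- The forgetful adjoint map `ad : [X, Ω_γ G] → [SX, G]`. -/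
def ad {a b : G} (γ : Path a b) :
    HomotopyClasses X (PathClassSpace γ) → HomotopyClasses (Suspension X) G :=
  Quotient.map (adjointMap γ) (by
    rintro h₀ h₁ ⟨F⟩
    let K (s : I) : C(X, PathClassSpace γ) := F.curry s
    refine ⟨⟨⟨fun p => adjointMap γ (K p.1) p.2, ?_⟩, fun z => ?_, fun z => ?_⟩⟩
    · refine Suspension.isQuotientMap_mk.continuous_lift_prod_right ?_
      exact (PathClassSpace.continuous_eval γ).comp
        ((F.continuous.comp (continuous_fst.prodMk (continuous_fst.comp continuous_snd))).prodMk
          (continuous_snd.comp continuous_snd))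
    · simp [K]
    · simp [K])

end Paths

section Loops

variable {G : Type*} [TopologicalSpace G] [Group G] [IsTopologicalGroup G]

variable (G) in
/-- `Ω₀ G`: the space of null-homotopic loops in `G` based at the identity. -/
abbrev NullLoops := PathClassSpace (Path.refl (1 : G))

/-- `Ω₀ G` is a group under pointwise multiplication of loops. (The induced group structure on
`[X, Ω₀ G]` is also the one given by concatenation of loops.) -/
instance : Group (NullLoops G) where
  mul α β := ⟨⟨⟨fun t => α.1 t * β.1 t, by fun_prop⟩, by simp, by simp⟩, by
    obtain ⟨⟨F⟩, ⟨F'⟩⟩ := And.intro α.2 β.2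
    exact ⟨{ toFun := fun p => F p * F' p
             map_zero_left := fun x => by simp
             map_one_left := fun x => by simp
             prop' := fun t x hx => by
              rcases hx with rfl | rfl <;> simp }⟩⟩
  one := ⟨Path.refl 1, Path.Homotopic.refl _⟩
  inv α := ⟨⟨⟨fun t => (α.1 t)⁻¹, by fun_prop⟩, by simp, by simp⟩, by
    obtain ⟨F⟩ := α.2
    exact ⟨{ toFun := fun p => (F p)⁻¹
             map_zero_left := fun x => by simp
             map_one_left := fun x => by simp
             prop' := fun t x hx => by
              rcases hx with rfl | rfl <;> simp }⟩⟩
  mul_assoc α β δ := Subtype.ext (Path.ext (funext fun t => mul_assoc _ _ _))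
  one_mul α := Subtype.ext (Path.ext (funext fun t => one_mul _))
  mul_one α := Subtype.ext (Path.ext (funext fun t => mul_one _))
  inv_mul_cancel α := Subtype.ext (Path.ext (funext fun t => inv_mul_cancel _))

instance : IsTopologicalGroup (NullLoops G) where
  continuous_mul := by
    refine PathClassSpace.continuous_mk _ _ ?_ _
    exact ((PathClassSpace.continuous_eval _).comp
      ((continuous_fst.comp continuous_fst).prodMk continuous_snd)).mul
      ((PathClassSpace.continuous_eval _).comp
        ((continuous_snd.comp continuous_fst).prodMk continuous_snd))
  continuous_inv := by
    refine PathClassSpace.continuous_mk _ _ ?_ _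
    exact (PathClassSpace.continuous_eval _).inv

end Loops

/-! ### Turning obstructions -/

section Turning

variable {G : Type*} [TopologicalSpace G] [Group G] [IsTopologicalGroup G]
  {a b : G} (ha : a ∈ Subgroup.center G) (hb : b ∈ Subgroup.center G) (γ : Path a b)

/-- The path `t ↦ x γ(t) x⁻¹`, for a path `γ` between central elements. -/
def conjPath (x : G) : Path a b where
  toFun t := x * γ t * x⁻¹
  continuous_toFun := by fun_prop
  source' := by rw [γ.source, Subgroup.mem_center_iff.1 ha x, mul_inv_cancel_right]
  target' := by rw [γ.target, Subgroup.mem_center_iff.1 hb x, mul_inv_cancel_right]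

/-- The loop `t ↦ x γ(t) x⁻¹ γ(t)⁻¹`, for a path `γ` between central elements. -/
def commLoop (x : G) : Path (1 : G) 1 where
  toFun t := x * γ t * x⁻¹ * (γ t)⁻¹
  continuous_toFun := by fun_prop
  source' := by rw [γ.source, Subgroup.mem_center_iff.1 ha x]; simp
  target' := by rw [γ.target, Subgroup.mem_center_iff.1 hb x]; simp

variable [PathConnectedSpace G]

theorem conjPath_homotopic (x : G) : (conjPath ha hb γ x).Homotopic γ := by
  let p : Path x 1 := PathConnectedSpace.somePath x 1
  exact ⟨{ toFun := fun q => conjPath ha hb γ (p q.1) q.2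
           continuous_toFun := by
            change Continuous fun q : I × I => p q.1 * γ q.2 * (p q.1)⁻¹
            fun_prop
           map_zero_left := fun t => by simp
           map_one_left := fun t => by simp [conjPath]
           prop' := fun s t ht => by
            rcases ht with rfl | rfl <;> simp }⟩

theorem commLoop_homotopic (x : G) : (commLoop ha hb γ x).Homotopic (Path.refl 1) := by
  let p : Path x 1 := PathConnectedSpace.somePath x 1
  exact ⟨{ toFun := fun q => commLoop ha hb γ (p q.1) q.2
           continuous_toFun := by
            change Continuous fun q : I × I => p q.1 * γ q.2 * (p q.1)⁻¹ * (γ q.2)⁻¹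
            fun_prop
           map_zero_left := fun t => by simp
           map_one_left := fun t => by simp [commLoop]
           prop' := fun s t ht => by
            rcases ht with rfl | rfl <;> simp }⟩

/-- `ρ_γ : G → Ω_γ G`, `x ↦ (t ↦ x γ(t) x⁻¹)`. -/
def rho : C(G, PathClassSpace γ) where
  toFun x := ⟨conjPath ha hb γ x, conjPath_homotopic ha hb γ x⟩
  continuous_toFun := by
    refine PathClassSpace.continuous_mk _ _ ?_ _
    change Continuous fun q : G × I => q.1 * γ q.2 * q.1⁻¹
    fun_prop

/-- `ρ̄_γ : G → Ω₀ G`, `x ↦ (t ↦ x γ(t) x⁻¹ γ(t)⁻¹)`. -/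
def rhoBar : C(G, NullLoops G) where
  toFun x := ⟨commLoop ha hb γ x, commLoop_homotopic ha hb γ x⟩
  continuous_toFun := by
    refine PathClassSpace.continuous_mk _ _ ?_ _
    change Continuous fun q : G × I => q.1 * γ q.2 * q.1⁻¹ * (γ q.2)⁻¹
    fun_prop

variable {X : Type*} [TopologicalSpace X]

/-- The `γ`-turning obstruction map `to_γ = (ρ_γ)_* : [X, G] → [X, Ω_γ G]`. -/
def turningObs : HomotopyClasses X G → HomotopyClasses X (PathClassSpace γ) :=
  HomotopyClasses.postcomp (rho ha hb γ)

/-- The normalised `γ`-turning obstruction map `(ρ̄_γ)_* : [X, G] → [X, Ω₀ G]`. -/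
def normalisedTurningObs : HomotopyClasses X G → HomotopyClasses X (NullLoops G) :=
  HomotopyClasses.postcomp (rhoBar ha hb γ)

/-- The adjointed `γ`-turning obstruction map `TO_γ = ad ∘ to_γ : [X, G] → [SX, G]`; it sends `[g]`
to the class of `[x, t] ↦ g(x) γ(t) g(x)⁻¹`. -/
def TO (ξ : HomotopyClasses X G) : HomotopyClasses (Suspension X) G :=
  ad γ (turningObs ha hb γ ξ)

theorem TO_mk (g : C(X, G)) :
    TO ha hb γ (HomotopyClasses.mk g) =
      HomotopyClasses.mk (adjointMap γ ((rho ha hb γ).comp g)) := rfl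

theorem adjointMap_rho_apply (g : C(X, G)) (x : X) (t : I) :
    adjointMap γ ((rho ha hb γ).comp g) (Suspension.mk (x, t)) = g x * γ t * (g x)⁻¹ := rfl

end Turning

/-! ### The special orthogonal group -/

/-- The topological group `SO_n`, as a group of real `n × n` matrices. -/
abbrev SO (n : ℕ) : Type := Matrix.specialOrthogonalGroup (Fin n) ℝ

instance (n : ℕ) : IsTopologicalGroup (SO n) where
  continuous_inv := by
    refine Continuous.subtype_mk (f := fun A : SO n => star (A : Matrix (Fin n) (Fin n) ℝ)) ?_ _
    exact continuous_star.comp continuous_subtype_val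

/-- The element `-1` of `SO_{2k}`. -/
def negOne (k : ℕ) : SO (2 * k) :=
  ⟨-1, (Matrix.mem_orthogonalGroup_iff (Fin (2 * k)) ℝ).2 (by simp), by
    simp [Matrix.det_neg]⟩

theorem negOne_mem_center (k : ℕ) : negOne k ∈ Subgroup.center (SO (2 * k)) :=
  Subgroup.mem_center_iff.2 fun A => Subtype.ext (by simp [negOne])

section PathConnected

/- `SO_n` is path-connected: orthogonal matrices are products of reflections. -/

open Matrix

/-- The matrix of the reflection in the hyperplane orthogonal to `v`. -/
def reflMatrix {n : ℕ} (v : Fin n → ℝ) : Matrix (Fin n) (Fin n) ℝ :=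
  1 - (2 / (v ⬝ᵥ v)) • Matrix.vecMulVec v v

lemma reflMatrix_mul_self {n : ℕ} (v : Fin n → ℝ) : reflMatrix v * reflMatrix v = 1 := by
  unfold reflMatrix
  rw [sub_mul, mul_sub, mul_sub]
  simp only [one_mul, mul_one, smul_mul_smul_comm, vecMulVec_mul_vecMulVec]
  have h : 2 / (v ⬝ᵥ v) * (2 / (v ⬝ᵥ v)) * (v ⬝ᵥ v) = 2 / (v ⬝ᵥ v) + 2 / (v ⬝ᵥ v) := by
    by_cases h : v ⬝ᵥ v = 0
    · simp [h]
    · field_simp; norm_num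
  simp only [vecMulVec_smul, smul_smul, h, add_smul]
  abel

lemma reflMatrix_mem {n : ℕ} (v : Fin n → ℝ) : reflMatrix v ∈ Matrix.orthogonalGroup (Fin n) ℝ := by
  rw [Matrix.mem_orthogonalGroup_iff]
  have : (reflMatrix v)ᵀ = reflMatrix v := by
    simp [reflMatrix, transpose_vecMulVec]
  rw [this, reflMatrix_mul_self]

lemma det_reflMatrix {n : ℕ} {v : Fin n → ℝ} (hv : v ≠ 0) : (reflMatrix v).det = -1 := by
  have h0 : v ⬝ᵥ v ≠ 0 := by simpa using hv
  have : reflMatrix v = 1 + replicateCol Unit (-(2 / (v ⬝ᵥ v)) • v) * replicateRow Unit v := by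
    rw [reflMatrix, ← vecMulVec_eq, smul_vecMulVec, neg_smul, sub_eq_add_neg]
  rw [this, det_one_add_replicateCol_mul_replicateRow]
  simp only [dotProduct_smul, smul_eq_mul]
  field_simp; norm_num

lemma exists_list {n : ℕ} {A : Matrix (Fin n) (Fin n) ℝ} (hA : A ∈ Matrix.orthogonalGroup (Fin n) ℝ) :
    ∃ l : List (Fin n → ℝ), A = (l.map reflMatrix).prod := by
  have hA' := (Matrix.mem_orthogonalGroup_iff' (Fin n) ℝ).1 hA
  let L : EuclideanSpace ℝ (Fin n) →ₗᵢ[ℝ] EuclideanSpace ℝ (Fin n) :=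
    { toLinearMap := Matrix.toEuclideanLin A
      norm_map' := fun x => by
        rw [← sq_eq_sq₀ (norm_nonneg _) (norm_nonneg _), EuclideanSpace.real_norm_sq_eq,
          EuclideanSpace.real_norm_sq_eq]
        have : (A *ᵥ x.ofLp) ⬝ᵥ (A *ᵥ x.ofLp) = x.ofLp ⬝ᵥ x.ofLp := by
          rw [Matrix.dotProduct_mulVec, Matrix.vecMul_mulVec, ← Matrix.dotProduct_mulVec, hA']
          simp
        simpa [dotProduct, sq] using this }
  obtain ⟨l, -, hl⟩ := (L.toLinearIsometryEquiv rfl).reflections_generate_dim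
  refine ⟨l.map WithLp.ofLp, ?_⟩
  have key : ∀ (l : List (EuclideanSpace ℝ (Fin n))) (x : EuclideanSpace ℝ (Fin n)),
      ((l.map fun v => (ℝ ∙ v)ᗮ.reflection).prod x).ofLp =
        ((l.map WithLp.ofLp).map reflMatrix).prod *ᵥ x.ofLp := by
    intro l
    induction l with
    | nil => intro x; simp
    | cons v l ih =>
      intro x
      simp only [List.map_cons, List.prod_cons, ← Matrix.mulVec_mulVec, ← ih x]
      rw [LinearIsometryEquiv.coe_mul, Function.comp_apply]
      generalize ((l.map fun v => (ℝ ∙ v)ᗮ.reflection).prod x) = y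
      rw [Submodule.reflection_orthogonal_apply, Submodule.reflection_singleton_apply]
      have h1 : (inner ℝ v y : ℝ) = v.ofLp ⬝ᵥ y.ofLp := by
        simp [PiLp.inner_apply, dotProduct, mul_comm]
      have h2 : ‖v‖ ^ 2 = v.ofLp ⬝ᵥ v.ofLp := by
        rw [EuclideanSpace.real_norm_sq_eq]; simp [dotProduct, sq]
      simp only [RCLike.ofReal_real_eq_id, id_eq, h1, h2]
      ext i
      simp [reflMatrix, sub_mulVec, smul_mulVec, vecMulVec_mulVec]
      ring
  apply Matrix.toEuclideanLin.injective
  ext x i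
  have := key l x
  rw [← hl] at this
  have := congrFun this i
  simpa [L] using this

lemma joined_reflMatrix {n : ℕ} (hn : 2 ≤ n) {v w : Fin n → ℝ} (hv : v ≠ 0) (hw : w ≠ 0) :
    Joined (⟨reflMatrix v, reflMatrix_mem v⟩ : Matrix.orthogonalGroup (Fin n) ℝ)
      ⟨reflMatrix w, reflMatrix_mem w⟩ := by
  have hr : 1 < Module.rank ℝ (Fin n → ℝ) := by
    rw [rank_fin_fun]; exact_mod_cast hn
  have h := (isPathConnected_compl_singleton_of_one_lt_rank hr 0).joinedIn v hv w hw
  have h' := (joinedIn_iff_joined (by exact hv) (by exact hw)).1 h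
  let f : ({0}ᶜ : Set (Fin n → ℝ)) → Matrix.orthogonalGroup (Fin n) ℝ :=
    fun u => ⟨reflMatrix u.1, reflMatrix_mem u.1⟩
  have hf : Continuous f := by
    refine Continuous.subtype_mk ?_ _
    have hd : Continuous fun u : ({0}ᶜ : Set (Fin n → ℝ)) => u.1 ⬝ᵥ u.1 :=
      continuous_subtype_val.dotProduct continuous_subtype_val
    refine continuous_const.sub (Continuous.smul (continuous_const.div hd fun u => ?_) ?_)
    · simpa using (show u.1 ≠ 0 from u.2)
    · exact continuous_subtype_val.matrix_vecMulVec continuous_subtype_val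
  exact h'.map hf

lemma joined_list {n : ℕ} (hn : 2 ≤ n) {e : Fin n → ℝ} (he : e ≠ 0) (l : List (Fin n → ℝ))
    (A : Matrix.orthogonalGroup (Fin n) ℝ) (hA : (A : Matrix (Fin n) (Fin n) ℝ) = (l.map reflMatrix).prod) :
    Joined A 1 ∨ Joined A ⟨reflMatrix e, reflMatrix_mem e⟩ := by
  induction l generalizing A with
  | nil => exact .inl (by rw [show A = 1 from Subtype.ext (by simpa using hA)])
  | cons v l ih =>
    let V : Matrix.orthogonalGroup (Fin n) ℝ := ⟨reflMatrix v, reflMatrix_mem v⟩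
    have hVA : V * A = V * A := rfl
    have hB := ih (V * A) (by
      simp only [Submonoid.coe_mul, hA, List.map_cons, List.prod_cons, V]
      rw [← mul_assoc, reflMatrix_mul_self, one_mul])
    have hVV : V * V = 1 := Subtype.ext (reflMatrix_mul_self v)
    have hAV : A = V * (V * A) := by rw [← mul_assoc, hVV, one_mul]
    by_cases hv : v = 0
    · have : V = 1 := Subtype.ext (by simp [V, hv, reflMatrix])
      rwa [this, one_mul] at hB
    · have hV := joined_reflMatrix hn hv he
      rcases hB with hB | hB
      · right
        have := hV.mul hB
        rw [mul_one] at this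
        rwa [hAV]
      · left
        have := hV.mul hB
        rw [show (⟨reflMatrix e, reflMatrix_mem e⟩ : Matrix.orthogonalGroup (Fin n) ℝ) *
          ⟨reflMatrix e, reflMatrix_mem e⟩ = 1 from Subtype.ext (reflMatrix_mul_self e)] at this
        rwa [hAV]

lemma det_path {n : ℕ} {A B : Matrix.orthogonalGroup (Fin n) ℝ} (p : Path A B)
    (hA : (A : Matrix (Fin n) (Fin n) ℝ).det = 1) (t : unitInterval) :
    (p t : Matrix (Fin n) (Fin n) ℝ).det = 1 := by
  have hsq (C : Matrix.orthogonalGroup (Fin n) ℝ) :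
      (C : Matrix (Fin n) (Fin n) ℝ).det * (C : Matrix (Fin n) (Fin n) ℝ).det = 1 := by
    have := congrArg Matrix.det ((Matrix.mem_orthogonalGroup_iff (Fin n) ℝ).1 C.2)
    simpa using this
  by_contra h
  have h1 : (p t : Matrix (Fin n) (Fin n) ℝ).det = -1 :=
    (mul_self_eq_one_iff.1 (hsq (p t))).resolve_left h
  have hc : Continuous fun s => (p s : Matrix (Fin n) (Fin n) ℝ).det :=
    (continuous_subtype_val.comp p.continuous).matrix_det
  obtain ⟨s, hs⟩ := mem_range_of_exists_le_of_exists_ge (c := (0 : ℝ)) hc ⟨t, by simp [h1]⟩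
    ⟨0, by simp [hA]⟩
  have := hsq (p s)
  simp only at hs
  rw [hs] at this
  norm_num at this

instance (n : ℕ) : PathConnectedSpace (SO n) := by
  have key (A : SO n) : Joined A 1 := by
    rcases Nat.lt_or_ge n 2 with hn | hn
    · have : A = 1 := by
        apply Subtype.ext
        have h := A.2.2
        interval_cases n
        · exact Subsingleton.elim _ _
        · ext i j
          have hdet : (A : Matrix (Fin 1) (Fin 1) ℝ).det = 1 := h
          rw [Matrix.det_fin_one] at hdet
          fin_cases i; fin_cases j
          simpa using hdet
      rw [this]
    · have he : (fun _ => 1 : Fin n → ℝ) ≠ 0 := fun h => by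
        simpa using congrFun h ⟨0, by omega⟩
      have hdet : (A : Matrix (Fin n) (Fin n) ℝ).det = 1 := A.2.2
      obtain ⟨l, hl⟩ := exists_list A.2.1
      rcases joined_list hn he l ⟨A.1, A.2.1⟩ hl with ⟨⟨p⟩⟩ | ⟨⟨p⟩⟩
      · exact ⟨{ toFun := fun t => ⟨(p t).1, (p t).2, det_path p hdet t⟩
                 continuous_toFun :=
                  Continuous.subtype_mk (continuous_subtype_val.comp p.continuous) _
                 source' := by simp
                 target' := by simp }⟩
      · have := det_path p hdet 1
        rw [p.target] at this
        simp only at this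
        rw [det_reflMatrix he] at this
        norm_num at this
  exact ⟨⟨1⟩, fun A B => (key A).trans (key B).symm⟩

end PathConnected

end TurningObstruction

end

open TurningObstruction

noncomputable section

namespace TurningObstruction

open Topology unitInterval

/-! ### Paths in a topological group up to homotopy, under pointwise multiplication -/

section PathGroup

variable {G : Type*} [TopologicalSpace G] [Group G] [IsTopologicalGroup G]

/-! Paths in a topological group `G`, modulo homotopy relative to the end points, form a group under
pointwise multiplication. Both turning obstructions of a fixed `g` depend only on the class of the
path in this group (`TO_congr`, `normalisedTurningObs_congr`) and turn products of paths into sums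
(`TO_add`, `normalisedTurningObs_add`). So everything reduces to three relations between classes:
`[η * γ] = [η][γ]`, `[η]² = 1` and `[γ]² = [η]ᵏ`.

The first is an Eckmann–Hilton argument (`pathClass_trans`). For the others, let `r` be the class of
a full rotation in a coordinate plane. A half turn using a third direction reverses this rotation,
so `r² = 1` (`pathClass_rotLoop_sq`). Every loop is a power of `r` (`pathClass_loop_eq_zpow`): by
general position a loop is pushed from `SO_{m+1}` into `SO_m` for `m ≥ 2`, and in `SO_2` an angle is
lifted. Hence a generating loop `η` has class `r`.

Simultaneous half turns in the `k` coordinate planes give a path `u` from `1` to `-1` with `[u]² =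
rᵏ` (`exists_path_negOne`). Any other `γ` is a loop times `u`; the loop class commutes with `[u]`
and has square one, so `[γ]² = [u]²` (`pathClass_sq_eq`). -/

variable (G) in
/-- Homotopy relative to the end points, as a congruence on the group of all paths in `G`. -/
def pathCon : Con C(I, G) where
  r f g := f.HomotopicRel g {0, 1}
  iseqv := ContinuousMap.HomotopicRel.equivalence
  mul' := by
    rintro f f' g g' ⟨F⟩ ⟨F'⟩
    exact ⟨{ toFun := fun p => F p * F' p
             map_zero_left := fun x => by simp
             map_one_left := fun x => by simp
             prop' := fun t x hx => by
              have h1 := F.eq_fst t hx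
              have h2 := F'.eq_fst t hx
              simp [h1, h2] }⟩

/-- The class of a path up to homotopy relative to the end points. -/
def pathClass : C(I, G) →* (pathCon G).Quotient := (pathCon G).mk'

theorem pathClass_eq_iff {f g : C(I, G)} :
    pathClass f = pathClass g ↔ f.HomotopicRel g {0, 1} := (pathCon G).eq

theorem pathClass_eq_of_homotopy {f g : C(I, G)} (K : I × I → G) (hK : Continuous K)
    (h0 : ∀ t, K (0, t) = f t) (h1 : ∀ t, K (1, t) = g t)
    (hl : ∀ s, K (s, 0) = f 0) (hr : ∀ s, K (s, 1) = f 1) : pathClass f = pathClass g :=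
  pathClass_eq_iff.2
    ⟨{ toFun := K
       continuous_toFun := hK
       map_zero_left := h0
       map_one_left := h1
       prop' := fun s t ht => by
        rcases ht with rfl | rfl
        · exact hl s
        · exact hr s }⟩

theorem exists_homotopy_of_pathClass_eq {f g : C(I, G)} (h : pathClass f = pathClass g) :
    ∃ K : I × I → G, Continuous K ∧ (∀ t, K (0, t) = f t) ∧ (∀ t, K (1, t) = g t) ∧
      (∀ s, K (s, 0) = f 0) ∧ ∀ s, K (s, 1) = f 1 := by
  obtain ⟨F⟩ := pathClass_eq_iff.1 h
  exact ⟨F, F.continuous, F.apply_zero, F.apply_one, fun s => F.eq_fst s (by simp),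
    fun s => F.eq_fst s (by simp)⟩

/-- Conjugating a loop by a path that starts at `1` does not change its class. -/
theorem pathClass_conj (u f : C(I, G)) (hu : u 0 = 1) (h0 : f 0 = 1) (h1 : f 1 = 1) :
    pathClass u * pathClass f * (pathClass u)⁻¹ = pathClass f := by
  rw [← map_mul, ← map_inv, ← map_mul]
  symm
  -- Conjugate by the initial segment `t ↦ u (s * t)`. The end points stay at `1` because `f` is `1`
  -- there, so `u` need not be a loop.
  refine pathClass_eq_of_homotopy (fun p => u (p.1 * p.2) * f p.2 * (u (p.1 * p.2))⁻¹)
    (by fun_prop) ?_ ?_ ?_ ?_ <;> intro t <;> simp [hu, h0, h1]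

/-- Conjugating a loop by an element in the path component of `1` does not change its class. -/
theorem pathClass_const_conj [PathConnectedSpace G] (x : G) (f : C(I, G)) (h0 : f 0 = 1)
    (h1 : f 1 = 1) :
    pathClass (ContinuousMap.const I x * f * (ContinuousMap.const I x)⁻¹) = pathClass f := by
  let p : Path 1 x := PathConnectedSpace.somePath 1 x
  symm
  refine pathClass_eq_of_homotopy (fun q => p q.1 * f q.2 * (p q.1)⁻¹)
    (by fun_prop) ?_ ?_ ?_ ?_ <;> intro t <;> simp [h0, h1]

/-- Concatenation and pointwise multiplication agree up to homotopy. -/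
theorem pathClass_trans {b : G} (η : Path (1 : G) 1) (γ : Path (1 : G) b) :
    pathClass (η.trans γ).toContinuousMap =
      pathClass η.toContinuousMap * pathClass γ.toContinuousMap := by
  -- Eckmann–Hilton: pad `η` and `γ` with constant paths on opposite halves; the pointwise product
  -- of the padded paths is exactly the concatenation.
  have e1 : pathClass (η.trans (Path.refl 1)).toContinuousMap = pathClass η.toContinuousMap :=
    pathClass_eq_iff.2 ⟨Path.Homotopy.transRefl η⟩
  have e2 : pathClass ((Path.refl 1).trans γ).toContinuousMap = pathClass γ.toContinuousMap :=
    pathClass_eq_iff.2 ⟨Path.Homotopy.reflTrans γ⟩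
  rw [← e1, ← e2, ← map_mul]
  congr 1
  ext t
  change (η.trans γ) t = (η.trans (Path.refl 1)) t * ((Path.refl 1).trans γ) t
  simp only [Path.trans_apply]
  split_ifs <;> simp

theorem pathClass_mul {a b a' b' : G} (δ : Path a b) (δ' : Path a' b') :
    pathClass (δ.mul δ').toContinuousMap =
      pathClass δ.toContinuousMap * pathClass δ'.toContinuousMap := by
  rw [← map_mul]
  rfl

theorem pathClass_refl_one : pathClass (Path.refl (1 : G)).toContinuousMap = 1 :=
  map_one pathClass

end PathGroup

/-! ### Homotopies of maps out of suspensions and into loop spaces -/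

theorem conj_eq_of_mem_center {G : Type*} [Group G] {a : G} (ha : a ∈ Subgroup.center G) (x : G) : x * a * x⁻¹ = a := by
  rw [Subgroup.mem_center_iff.1 ha x, mul_inv_cancel_right]

/-- Two maps out of a suspension are homotopic if they are related by a homotopy on `X × I` that is
constant on each end. -/
theorem homotopic_of_suspension_homotopy {X G : Type*} [TopologicalSpace X]
    [TopologicalSpace G] {f f' : C(Suspension X, G)} (K : I × X × I → G)
    (hK : Continuous K) (h0 : ∀ x t, K (0, x, t) = f (Suspension.mk (x, t)))
    (h1 : ∀ x t, K (1, x, t) = f' (Suspension.mk (x, t)))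
    (hl : ∀ s x y, K (s, x, 0) = K (s, y, 0)) (hr : ∀ s x y, K (s, x, 1) = K (s, y, 1)) :
    f.Homotopic f' := by
  let L : I × Suspension X → G := fun p => Quot.lift (fun q : X × I => K (p.1, q)) (by
    rintro ⟨x, t⟩ ⟨y, s⟩ (⟨e1, e2⟩ | ⟨e1, e2⟩)
    · obtain rfl : t = 0 := e1
      obtain rfl : s = 0 := e2
      exact hl _ _ _
    · obtain rfl : t = 1 := e1
      obtain rfl : s = 1 := e2
      exact hr _ _ _) p.2
  refine ⟨⟨⟨L, ?_⟩, ?_, ?_⟩⟩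
  -- Local compactness of `I` ensures that the product of `I` with the quotient map is again a
  -- quotient map.
  · exact Suspension.isQuotientMap_mk.continuous_lift_prod_right hK
  · rintro ⟨x, t⟩
    exact h0 x t
  · rintro ⟨x, t⟩
    exact h1 x t

/-- Two maps into the space of null-homotopic loops are homotopic if their adjoints are related by
a homotopy through loops. -/
theorem homotopic_of_loop_homotopy {X G : Type*} [TopologicalSpace X] [TopologicalSpace G]
    [Group G] {f f' : C(X, NullLoops G)} (K : I × X × I → G)
    (hK : Continuous K) (h0 : ∀ x t, K (0, x, t) = (f x).1 t)
    (h1 : ∀ x t, K (1, x, t) = (f' x).1 t)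
    (hl : ∀ s x, K (s, x, 0) = 1) (hr : ∀ s x, K (s, x, 1) = 1) :
    f.Homotopic f' := by
  let L (p : I × X) : Path (1 : G) 1 :=
    { toFun := fun t => K (p.1, p.2, t)
      continuous_toFun := by fun_prop
      source' := hl _ _
      target' := hr _ _ }
  have hL (p : I × X) : (L p).Homotopic (Path.refl 1) := by
    -- Intermediate loops are null-homotopic: the part of `K` up to time `p.1` joins them to the
    -- null-homotopic loop `f p.2`.
    refine Path.Homotopic.trans (Path.Homotopic.symm ?_) (f p.2).2
    exact ⟨{ toFun := fun q => K (p.1 * q.1, p.2, q.2)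
             continuous_toFun := by fun_prop
             map_zero_left := fun t => by simpa using h0 p.2 t
             map_one_left := fun t => by simp [L]
             prop' := fun s t ht => by
              rcases ht with rfl | rfl <;> simp [hl, hr] }⟩
  refine ⟨⟨⟨fun p => ⟨L p, hL p⟩, ?_⟩, fun x => ?_, fun x => ?_⟩⟩
  · refine PathClassSpace.continuous_mk _ L ?_ hL
    change Continuous fun q : (I × X) × I => K (q.1.1, q.1.2, q.2)
    fun_prop
  · exact Subtype.ext (Path.ext (funext fun t => h0 x t))
  · exact Subtype.ext (Path.ext (funext fun t => h1 x t))

/-! ### Turning obstructions depend only on the class of the path, multiplicatively -/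

section Calculus

variable {G : Type*} [TopologicalSpace G] [Group G] [IsTopologicalGroup G] [PathConnectedSpace G]
  {a b a' b' : G} (ha : a ∈ Subgroup.center G) (hb : b ∈ Subgroup.center G)
  (ha' : a' ∈ Subgroup.center G) (hb' : b' ∈ Subgroup.center G)
  {X : Type*} [TopologicalSpace X]

/-- A homotopy relative to the end points can be conjugated by `g x`; its ends are central, so the
result descends to the suspension. The end points of the two paths are separate variables because
products of paths end at products such as `negOne k * negOne k`. -/
theorem TO_congr (g : C(X, G)) (δ : Path a b) (δ' : Path a' b')
    (h : pathClass δ.toContinuousMap = pathClass δ'.toContinuousMap) :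
    TO ha hb δ (HomotopyClasses.mk g) = TO ha' hb' δ' (HomotopyClasses.mk g) := by
  obtain ⟨K, hK, h0, h1, hl, hr⟩ := exists_homotopy_of_pathClass_eq h
  replace hl : ∀ s, K (s, 0) = a := by simpa using hl
  replace hr : ∀ s, K (s, 1) = b := by simpa using hr
  rw [TO_mk, TO_mk, HomotopyClasses.mk_eq_mk]
  refine homotopic_of_suspension_homotopy (fun p => g p.2.1 * K (p.1, p.2.2) * (g p.2.1)⁻¹)
    (by fun_prop) ?_ ?_ ?_ ?_
  · intro x t
    rw [adjointMap_rho_apply]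
    simp [h0]
  · intro x t
    rw [adjointMap_rho_apply]
    simp [h1]
  · intro s x y
    simp [hl, conj_eq_of_mem_center ha]
  · intro s x y
    simp [hr, conj_eq_of_mem_center hb]

/-- Conjugation is multiplicative, so this already holds for representatives, without a homotopy. -/
theorem TO_add (g : C(X, G)) (δ : Path a b) (δ' : Path a' b') :
    TO ha hb δ (HomotopyClasses.mk g) + TO ha' hb' δ' (HomotopyClasses.mk g) =
      TO (mul_mem ha ha') (mul_mem hb hb') (δ.mul δ') (HomotopyClasses.mk g) := by
  rw [TO_mk, TO_mk, TO_mk, HomotopyClasses.mk_add_mk]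
  congr 1
  ext z
  obtain ⟨⟨x, t⟩, rfl⟩ := Suspension.isQuotientMap_mk.surjective z
  rw [ContinuousMap.mul_apply, adjointMap_rho_apply, adjointMap_rho_apply, adjointMap_rho_apply]
  change _ = g x * (δ t * δ' t) * (g x)⁻¹
  group

theorem TO_refl_one (g : C(X, G)) :
    TO (one_mem _) (one_mem _) (Path.refl (1 : G)) (HomotopyClasses.mk g) = 0 := by
  rw [TO_mk, HomotopyClasses.zero_def]
  congr 1
  ext z
  obtain ⟨⟨x, t⟩, rfl⟩ := Suspension.isQuotientMap_mk.surjective z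
  rw [adjointMap_rho_apply]
  simp

theorem rhoBar_apply (δ : Path a b) (x : G) (t : I) :
    (rhoBar ha hb δ x).1 t = x * δ t * x⁻¹ * (δ t)⁻¹ := rfl

theorem normalisedTurningObs_mk (g : C(X, G)) (δ : Path a b) :
    normalisedTurningObs ha hb δ (HomotopyClasses.mk g) =
      HomotopyClasses.mk ((rhoBar ha hb δ).comp g) := rfl

theorem normalisedTurningObs_congr (g : C(X, G)) (δ : Path a b) (δ' : Path a' b')
    (h : pathClass δ.toContinuousMap = pathClass δ'.toContinuousMap) :
    normalisedTurningObs ha hb δ (HomotopyClasses.mk g) =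
      normalisedTurningObs ha' hb' δ' (HomotopyClasses.mk g) := by
  obtain ⟨K, hK, h0, h1, hl, hr⟩ := exists_homotopy_of_pathClass_eq h
  replace hl : ∀ s, K (s, 0) = a := by simpa using hl
  replace hr : ∀ s, K (s, 1) = b := by simpa using hr
  rw [normalisedTurningObs_mk, normalisedTurningObs_mk, HomotopyClasses.mk_eq_mk]
  refine homotopic_of_loop_homotopy
    (fun p => g p.2.1 * K (p.1, p.2.2) * (g p.2.1)⁻¹ * (K (p.1, p.2.2))⁻¹)
    (by fun_prop) ?_ ?_ ?_ ?_
  · intro x t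
    simp [h0, rhoBar_apply]
  · intro x t
    simp [h1, rhoBar_apply]
  · intro s x
    simp [hl, conj_eq_of_mem_center ha]
  · intro s x
    simp [hr, conj_eq_of_mem_center hb]

/-- The commutator identity `[g, δδ'] = [g, δ] · δ[g, δ']δ⁻¹` leaves a conjugation by `δ t` to be
removed. This is done by conjugating with `(δ 0)⁻¹ * δ (s * t)`, which is `1` at `s = 0`; at `s = 1`
the central factor `(δ 0)⁻¹` drops out. -/
theorem normalisedTurningObs_add (g : C(X, G)) (δ : Path a b) (δ' : Path a' b') :
    normalisedTurningObs ha hb δ (HomotopyClasses.mk g) +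
        normalisedTurningObs ha' hb' δ' (HomotopyClasses.mk g) =
      normalisedTurningObs (mul_mem ha ha') (mul_mem hb hb') (δ.mul δ')
        (HomotopyClasses.mk g) := by
  rw [normalisedTurningObs_mk, normalisedTurningObs_mk, normalisedTurningObs_mk,
    HomotopyClasses.mk_add_mk, HomotopyClasses.mk_eq_mk]
  have hconj : ∀ c ∈ Subgroup.center G, ∀ x y : G, y * (x * c * x⁻¹ * c⁻¹) * y⁻¹ = 1 := by
    intro c hc x y
    simp [conj_eq_of_mem_center hc]
  refine homotopic_of_loop_homotopy
    (fun p => (g p.2.1 * δ p.2.2 * (g p.2.1)⁻¹ * (δ p.2.2)⁻¹) *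
      ((δ 0)⁻¹ * δ (p.1 * p.2.2) *
        (g p.2.1 * δ' p.2.2 * (g p.2.1)⁻¹ * (δ' p.2.2)⁻¹) * ((δ 0)⁻¹ * δ (p.1 * p.2.2))⁻¹))
    (by fun_prop) ?_ ?_ ?_ ?_
  · intro x t
    simp only [zero_mul, inv_mul_cancel, one_mul, inv_one, mul_one]
    rfl
  · intro x t
    simp only [one_mul]
    change _ = g x * (δ t * δ' t) * (g x)⁻¹ * (δ t * δ' t)⁻¹
    have h := Subgroup.mem_center_iff.1 (inv_mem ha)
      (δ t * (g x * δ' t * (g x)⁻¹ * (δ' t)⁻¹) * (δ t)⁻¹)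
    rw [δ.source, show a⁻¹ * δ t * (g x * δ' t * (g x)⁻¹ * (δ' t)⁻¹) * (a⁻¹ * δ t)⁻¹ =
      a⁻¹ * (δ t * (g x * δ' t * (g x)⁻¹ * (δ' t)⁻¹) * (δ t)⁻¹) * a by group, ← h]
    group
  · intro s x
    rw [hconj _ (by simpa using ha')]
    simp [conj_eq_of_mem_center ha]
  · intro s x
    rw [hconj _ (by simpa using hb')]
    simp [conj_eq_of_mem_center hb]

theorem normalisedTurningObs_refl_one (g : C(X, G)) :
    normalisedTurningObs (one_mem _) (one_mem _) (Path.refl (1 : G)) (HomotopyClasses.mk g) = 0 := by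
  rw [normalisedTurningObs_mk, HomotopyClasses.zero_def]
  congr 1
  ext x
  refine Subtype.ext (Path.ext (funext fun t => ?_))
  change g x * 1 * (g x)⁻¹ * 1⁻¹ = 1
  simp

end Calculus

/-! ### Plane rotations -/

section PlaneRotations

open Matrix

variable {n : ℕ}

/-- `(e, f)` is an orthonormal pair. -/
def IsOrthoPair (e f : Fin n → ℝ) : Prop := e ⬝ᵥ e = 1 ∧ f ⬝ᵥ f = 1 ∧ e ⬝ᵥ f = 0

theorem coe_inv_SO (A : SO n) : ((A⁻¹ : SO n) : Matrix (Fin n) (Fin n) ℝ) = (A.1)ᵀ := by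
  ext i j
  rfl

theorem transpose_mul_self_SO (A : SO n) : (A.1)ᵀ * A.1 = 1 := by
  rw [← coe_inv_SO, ← Submonoid.coe_mul, inv_mul_cancel]
  rfl

theorem mulVec_dotProduct_mulVec (A : SO n) (v w : Fin n → ℝ) :
    (A.1 *ᵥ v) ⬝ᵥ (A.1 *ᵥ w) = v ⬝ᵥ w := by
  rw [Matrix.dotProduct_mulVec, Matrix.vecMul_mulVec, ← Matrix.dotProduct_mulVec,
    transpose_mul_self_SO, one_mulVec]

theorem mk_SO_mem {A : Matrix (Fin n) (Fin n) ℝ} (h : A * Aᵀ = 1) (hd : A.det = 1) :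
    A ∈ Matrix.specialOrthogonalGroup (Fin n) ℝ :=
  ⟨(Matrix.mem_orthogonalGroup_iff (Fin n) ℝ).2 h, hd⟩

/-- The rotation by the angle `θ` in the plane spanned by the orthonormal pair `(e, f)`. -/
def planeRot (e f : Fin n → ℝ) (θ : ℝ) : Matrix (Fin n) (Fin n) ℝ :=
  1 + (Real.cos θ - 1) • (vecMulVec e e + vecMulVec f f) +
    Real.sin θ • (vecMulVec f e - vecMulVec e f)

@[simp] theorem planeRot_zero (e f : Fin n → ℝ) : planeRot e f 0 = 1 := by
  simp [planeRot]

theorem planeRot_transpose (e f : Fin n → ℝ) (θ : ℝ) : (planeRot e f θ)ᵀ = planeRot e f (-θ) := by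
  simp only [planeRot, transpose_add, transpose_smul, transpose_sub, transpose_vecMulVec,
    transpose_one, Real.cos_neg, Real.sin_neg]
  module

theorem planeRot_neg_right (e f : Fin n → ℝ) (θ : ℝ) : planeRot e (-f) θ = planeRot e f (-θ) := by
  simp only [planeRot, Real.cos_neg, Real.sin_neg, neg_vecMulVec, vecMulVec_neg]
  module

theorem planeRot_add {e f : Fin n → ℝ} (h : IsOrthoPair e f) (θ φ : ℝ) :
    planeRot e f (θ + φ) = planeRot e f θ * planeRot e f φ := by
  obtain ⟨h1, h2, h3⟩ := h
  have h4 : f ⬝ᵥ e = 0 := by rw [dotProduct_comm, h3]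
  -- `P` is the projection onto the plane and `K` the quarter turn in it, extended by zero. The
  -- relations `P² = P`, `PK = KP = K`, `K² = -P` reduce the claim to the addition formulas.
  set P := vecMulVec e e + vecMulVec f f with hP
  set K := vecMulVec f e - vecMulVec e f with hK
  have hPP : P * P = P := by
    simp [hP, mul_add, add_mul, vecMulVec_mul_vecMulVec, h1, h2, h3, h4]
  have hPK : P * K = K := by
    simp [hP, hK, mul_sub, add_mul, vecMulVec_mul_vecMulVec, h1, h2, h3, h4]
  have hKP : K * P = K := by
    simp [hP, hK, mul_add, sub_mul, vecMulVec_mul_vecMulVec, h1, h2, h3, h4]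
    abel
  have hKK : K * K = -P := by
    simp [hP, hK, mul_sub, sub_mul, vecMulVec_mul_vecMulVec, h1, h2, h3, h4]
    abel
  have key : ∀ t, planeRot e f t = 1 + (Real.cos t - 1) • P + Real.sin t • K := fun t => rfl
  rw [key, key, key, Real.cos_add, Real.sin_add]
  simp only [mul_add, add_mul, smul_mul_smul_comm, hPP, hPK, hKP, hKK, mul_one, one_mul]
  module

/-- Orthogonality gives determinant `±1`, and a rotation is the square of the rotation by half the
angle. -/
theorem det_planeRot {e f : Fin n → ℝ} (h : IsOrthoPair e f) (θ : ℝ) :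
    (planeRot e f θ).det = 1 := by
  have h1 : ∀ t, (planeRot e f t).det * (planeRot e f t).det = 1 := fun t => by
    nth_rewrite 2 [← det_transpose]
    rw [planeRot_transpose, ← det_mul, ← planeRot_add h, add_neg_cancel, planeRot_zero, det_one]
  rw [← add_halves θ, planeRot_add h, det_mul, h1]

/-- `planeRot` as an element of the special orthogonal group. -/
def rot {e f : Fin n → ℝ} (h : IsOrthoPair e f) (θ : ℝ) : SO n :=
  ⟨planeRot e f θ, mk_SO_mem
    (by rw [planeRot_transpose, ← planeRot_add h, add_neg_cancel, planeRot_zero])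
    (det_planeRot h θ)⟩

theorem rot_zero {e f : Fin n → ℝ} (h : IsOrthoPair e f) : rot h 0 = 1 :=
  Subtype.ext (planeRot_zero e f)

theorem rot_add {e f : Fin n → ℝ} (h : IsOrthoPair e f) (θ φ : ℝ) :
    rot h (θ + φ) = rot h θ * rot h φ := Subtype.ext (planeRot_add h θ φ)

theorem rot_neg {e f : Fin n → ℝ} (h : IsOrthoPair e f) (θ : ℝ) : rot h (-θ) = (rot h θ)⁻¹ := by
  rw [eq_inv_iff_mul_eq_one, ← rot_add, neg_add_cancel, rot_zero]

theorem rot_two_pi {e f : Fin n → ℝ} (h : IsOrthoPair e f) : rot h (2 * Real.pi) = 1 :=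
  Subtype.ext (by simp [rot, planeRot])

@[fun_prop]
theorem continuous_rot {e f : Fin n → ℝ} (h : IsOrthoPair e f) : Continuous (rot h) := by
  refine Continuous.subtype_mk ?_ _
  unfold planeRot
  fun_prop

theorem rot_mulVec {e f : Fin n → ℝ} (h : IsOrthoPair e f) (θ : ℝ) (v : Fin n → ℝ) :
    (rot h θ).1 *ᵥ v = v + (Real.cos θ - 1) • ((e ⬝ᵥ v) • e + (f ⬝ᵥ v) • f) +
      Real.sin θ • ((e ⬝ᵥ v) • f - (f ⬝ᵥ v) • e) := by
  simp [rot, planeRot, add_mulVec, sub_mulVec, smul_mulVec, vecMulVec_mulVec]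

theorem IsOrthoPair.mulVec {e f : Fin n → ℝ} (h : IsOrthoPair e f) (A : SO n) :
    IsOrthoPair (A.1 *ᵥ e) (A.1 *ᵥ f) := by
  simpa only [IsOrthoPair, mulVec_dotProduct_mulVec] using h

theorem conj_rot {e f : Fin n → ℝ} (h : IsOrthoPair e f) (A : SO n) (θ : ℝ) :
    A * rot h θ * A⁻¹ = rot (h.mulVec A) θ := by
  apply Subtype.ext
  have hA : A.1 * (A.1)ᵀ = 1 := by
    rw [← coe_inv_SO, ← Submonoid.coe_mul, mul_inv_cancel]; rfl
  have hv : ∀ u v : Fin n → ℝ, A.1 * vecMulVec u v * (A.1)ᵀ =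
      vecMulVec (A.1 *ᵥ u) (A.1 *ᵥ v) := fun u v => by
    rw [mul_vecMulVec, vecMulVec_mul, vecMul_transpose]
  simp only [Submonoid.coe_mul, coe_inv_SO, rot, planeRot]
  simp only [mul_add, add_mul, mul_sub, sub_mul, mul_smul_comm, smul_mul_assoc, hv, hA, mul_one]

/-- The loop that rotates once in the plane of an orthonormal pair. -/
def rotLoop {e f : Fin n → ℝ} (h : IsOrthoPair e f) : C(I, SO n) where
  toFun t := rot h (2 * Real.pi * t)

theorem rotLoop_apply {e f : Fin n → ℝ} (h : IsOrthoPair e f) (t : I) :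
    rotLoop h t = rot h (2 * Real.pi * t) := rfl

/-- Moving the plane by `A` conjugates the loop by `A`, which path-connectedness of `SO n` makes
invisible up to homotopy. -/
theorem pathClass_rotLoop_mulVec {e f : Fin n → ℝ} (h : IsOrthoPair e f) (A : SO n) :
    pathClass (rotLoop (h.mulVec A)) = pathClass (rotLoop h) := by
  rw [← pathClass_const_conj A (rotLoop h) (by simp [rotLoop_apply, rot_zero])
    (by simp [rotLoop_apply, rot_two_pi])]
  congr 1
  ext1 t
  exact (conj_rot h A _).symm

theorem rotLoop_neg_right {e f : Fin n → ℝ} (h : IsOrthoPair e f) (h' : IsOrthoPair e (-f)) :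
    rotLoop h' = (rotLoop h)⁻¹ := by
  ext1 t
  rw [ContinuousMap.inv_apply, rotLoop_apply, rotLoop_apply, ← rot_neg]
  exact Subtype.ext (planeRot_neg_right _ _ _)

/-- The half turn in the plane of `f` and `g` fixes `e` and negates `f`, so it carries the rotation
loop to its inverse. -/
theorem pathClass_rotLoop_sq {e f g : Fin n → ℝ} (h : IsOrthoPair e f) (hfg : IsOrthoPair f g)
    (heg : e ⬝ᵥ g = 0) : pathClass (rotLoop h) ^ 2 = 1 := by
  have hfe : f ⬝ᵥ e = 0 := by rw [dotProduct_comm]; exact h.2.2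
  have hge : g ⬝ᵥ e = 0 := by rw [dotProduct_comm]; exact heg
  have hgf : g ⬝ᵥ f = 0 := by rw [dotProduct_comm]; exact hfg.2.2
  have he : (rot hfg Real.pi).1 *ᵥ e = e := by simp [rot_mulVec, hfe, hge]
  have hf : (rot hfg Real.pi).1 *ᵥ f = -f := by
    simp only [rot_mulVec, hfg.1, hgf, Real.cos_pi, Real.sin_pi]
    module
  have h1 := pathClass_rotLoop_mulVec h (rot hfg Real.pi)
  have h2 : pathClass (rotLoop (h.mulVec (rot hfg Real.pi))) = (pathClass (rotLoop h))⁻¹ := by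
    have h3 := h.mulVec (rot hfg Real.pi)
    rw [← map_inv]
    have h4 : IsOrthoPair e (-f) := by rwa [he, hf] at h3
    rw [← rotLoop_neg_right h h4]
    congr 1
    congr 1
  rw [sq]
  nth_rewrite 2 [← h1]
  rw [h2, mul_inv_cancel]

/-- The standard basis vectors of `ℝⁿ`. -/
abbrev stdVec (i : Fin n) : Fin n → ℝ := Pi.single i 1

theorem isOrthoPair_stdVec {i j : Fin n} (hij : i ≠ j) : IsOrthoPair (stdVec i) (stdVec j) := by
  simp [IsOrthoPair, hij]

/-- Quarter turn from `e` to `f`. -/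
theorem rot_half_pi_mulVec_left {e f : Fin n → ℝ} (h : IsOrthoPair e f) :
    (rot h (Real.pi / 2)).1 *ᵥ e = f := by
  have hfe : f ⬝ᵥ e = 0 := by rw [dotProduct_comm]; exact h.2.2
  simp only [rot_mulVec, h.1, hfe, Real.cos_pi_div_two, Real.sin_pi_div_two]
  module

theorem rot_mulVec_of_orthogonal {e f v : Fin n → ℝ} (h : IsOrthoPair e f) (θ : ℝ)
    (h1 : e ⬝ᵥ v = 0) (h2 : f ⬝ᵥ v = 0) : (rot h θ).1 *ᵥ v = v := by
  simp [rot_mulVec, h1, h2]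

theorem rotLoop_congr {e f e' f' : Fin n → ℝ} (h : IsOrthoPair e f) (h' : IsOrthoPair e' f')
    (he : e = e') (hf : f = f') : rotLoop h = rotLoop h' := by
  subst he hf
  rfl

/-- Two quarter turns carry one plane to the other: the first takes `e` to `e'` and fixes `f`, the
second takes `f` to `f'` and fixes `e'`. -/
theorem pathClass_rotLoop_of_orthogonal {e f e' f' : Fin n → ℝ} (h : IsOrthoPair e f)
    (h' : IsOrthoPair e' f') (hee : e ⬝ᵥ e' = 0) (hfe : f ⬝ᵥ e' = 0)
    (hff : f ⬝ᵥ f' = 0) : pathClass (rotLoop h) = pathClass (rotLoop h') := by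
  have k1 : IsOrthoPair e e' := ⟨h.1, h'.1, hee⟩
  have k2 : IsOrthoPair f f' := ⟨h.2.1, h'.2.1, hff⟩
  have hfe' : f' ⬝ᵥ e' = 0 := by rw [dotProduct_comm]; exact h'.2.2
  have hef' : e' ⬝ᵥ f = 0 := by rw [dotProduct_comm]; exact hfe
  have a1 : (rot k1 (Real.pi / 2)).1 *ᵥ e = e' := rot_half_pi_mulVec_left k1
  have a2 : (rot k1 (Real.pi / 2)).1 *ᵥ f = f := rot_mulVec_of_orthogonal k1 _ h.2.2 hef'
  have a3 : (rot k2 (Real.pi / 2)).1 *ᵥ e' = e' := rot_mulVec_of_orthogonal k2 _ hfe hfe'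
  have a4 : (rot k2 (Real.pi / 2)).1 *ᵥ f = f' := rot_half_pi_mulVec_left k2
  rw [← pathClass_rotLoop_mulVec h (rot k1 (Real.pi / 2)),
    ← pathClass_rotLoop_mulVec _ (rot k2 (Real.pi / 2))]
  congr 1
  exact rotLoop_congr _ _ (by rw [a1, a3]) (by rw [a2, a4])

end PlaneRotations

/-! ### The half turn in all coordinate planes -/

section HalfTurn

open Matrix

/-- There is a path from `1` to `-1` in `SO_{2k}` whose square is homotopic to the `k`-th power of a
full rotation. -/
theorem exists_path_negOne (k : ℕ) {e f : Fin (2 * k) → ℝ} (h : IsOrthoPair e f)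
    (hr : ∀ (j : ℕ) (hj : j < k), pathClass (rotLoop (isOrthoPair_stdVec
      (i := (⟨2 * j, by omega⟩ : Fin (2 * k))) (j := ⟨2 * j + 1, by omega⟩) (by simp))) =
        pathClass (rotLoop h)) :
    ∃ u : C(I, SO (2 * k)), u 0 = 1 ∧ u 1 = negOne k ∧
      pathClass u ^ 2 = pathClass (rotLoop h) ^ k := by
  -- Here `u` is the product of the half turns in the first `m` coordinate planes. That every `u t`
  -- fixes the remaining basis vectors is carried along so that the next half turn commutes with
  -- `u`.
  have key : ∀ m ≤ k, ∃ u : C(I, SO (2 * k)), u 0 = 1 ∧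
      (∀ i : Fin (2 * k), (u 1).1 *ᵥ stdVec i = if i.1 < 2 * m then -stdVec i else stdVec i) ∧
      (∀ t, ∀ i : Fin (2 * k), 2 * m ≤ i.1 → (u t).1 *ᵥ stdVec i = stdVec i) ∧
      pathClass u ^ 2 = pathClass (rotLoop h) ^ m := by
    intro m
    induction m with
    | zero => exact fun _ => ⟨1, rfl, fun i => (one_mulVec _).trans (by simp),
      fun t i _ => one_mulVec _, by simp⟩
    | succ m ih =>
      intro hm
      obtain ⟨u, h0, h1, hfix, hsq⟩ := ih (by omega)
      let a : Fin (2 * k) := ⟨2 * m, by omega⟩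
      let b : Fin (2 * k) := ⟨2 * m + 1, by omega⟩
      have hab : a ≠ b := by simp [a, b]
      have hp := isOrthoPair_stdVec hab
      let v : C(I, SO (2 * k)) := ⟨fun t => rot hp (Real.pi * t), by fun_prop⟩
      have hv : ∀ t, v t = rot hp (Real.pi * t) := fun t => rfl
      have hvfix : ∀ t, ∀ i : Fin (2 * k), i ≠ a → i ≠ b → (v t).1 *ᵥ stdVec i = stdVec i := by
        intro t i hia hib
        rw [hv]
        exact rot_mulVec_of_orthogonal hp _ (by simp [hia.symm]) (by simp [hib.symm])
      have hcomm : v * u = u * v := by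
        ext1 t
        rw [ContinuousMap.mul_apply, ContinuousMap.mul_apply, hv]
        have := conj_rot hp (u t) (Real.pi * t)
        rw [mul_inv_eq_iff_eq_mul] at this
        rw [this]
        congr 1
        apply Subtype.ext
        change planeRot _ _ _ = planeRot _ _ _
        rw [hfix t a le_rfl, hfix t b (by simp [b])]
      have hvv : v ^ 2 = rotLoop hp := by
        ext1 t
        rw [sq, ContinuousMap.mul_apply, hv, ← rot_add, rotLoop_apply]
        congr 1
        ring
      have hne : ∀ i : Fin (2 * k), 2 * (m + 1) ≤ i.1 → i ≠ a ∧ i ≠ b := fun i hi =>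
        ⟨fun hh => by simp [hh, a] at hi, fun hh => by simp [hh, b] at hi; omega⟩
      refine ⟨u * v, ?_, ?_, ?_, ?_⟩
      · simp [h0, hv, rot_zero]
      · intro i
        rw [ContinuousMap.mul_apply, Submonoid.coe_mul, ← mulVec_mulVec]
        have hva : (v 1).1 *ᵥ stdVec a = -stdVec a := by
          simp only [hv, rot_mulVec]
          simp [hab.symm]
          module
        have hvb : (v 1).1 *ᵥ stdVec b = -stdVec b := by
          simp only [hv, rot_mulVec]
          simp [hab]
          module
        by_cases hia : i = a
        · subst hia
          rw [hva, mulVec_neg, hfix 1 _ le_rfl, if_pos (by simp [a])]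
        · by_cases hib : i = b
          · subst hib
            rw [hvb, mulVec_neg, hfix 1 _ (by simp [b]), if_pos (by simp [b]; omega)]
          · rw [hvfix 1 i hia hib, h1 i]
            have e1 : i.1 ≠ 2 * m := fun hh => hia (Fin.ext hh)
            have e2 : i.1 ≠ 2 * m + 1 := fun hh => hib (Fin.ext hh)
            congr 1
            apply propext
            omega
      · intro t i hi
        rw [ContinuousMap.mul_apply, Submonoid.coe_mul, ← mulVec_mulVec,
          hvfix t i (hne i hi).1 (hne i hi).2, hfix t i (by omega)]
      · have hc : Commute u v := hcomm.symm
        rw [← map_pow, hc.mul_pow, map_mul, map_pow, hsq, hvv, pow_succ]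
        congr 1
        exact hr m (by omega)
  obtain ⟨u, h0, h1, -, hsq⟩ := key k le_rfl
  refine ⟨u, h0, ?_, hsq⟩
  apply Subtype.ext
  apply Matrix.ext_of_mulVec_single
  intro i
  rw [h1 i, if_pos i.2]
  change -stdVec i = (-1 : Matrix _ _ ℝ) *ᵥ stdVec i
  rw [neg_mulVec, one_mulVec]

end HalfTurn

/-! ### Deforming loops in the special orthogonal group -/

section TurnVector

open Matrix

variable {n : ℕ}

theorem reflMatrix_mulVec (v x : Fin n → ℝ) :
    reflMatrix v *ᵥ x = x - (2 / (v ⬝ᵥ v) * (v ⬝ᵥ x)) • v := by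
  simp [reflMatrix, sub_mulVec, smul_mulVec, vecMulVec_mulVec, smul_smul]

theorem reflMatrix_mulVec_of_orthogonal {v x : Fin n → ℝ} (h : v ⬝ᵥ x = 0) :
    reflMatrix v *ᵥ x = x := by
  simp [reflMatrix_mulVec, h]

theorem continuous_reflMatrix {Y : Type*} [TopologicalSpace Y] {f : Y → Fin n → ℝ}
    (hf : Continuous f) (hne : ∀ y, f y ≠ 0) : Continuous fun y => reflMatrix (f y) := by
  refine continuous_const.sub (Continuous.smul (continuous_const.div (hf.dotProduct hf) fun y => ?_)
    (hf.matrix_vecMulVec hf))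
  simpa using hne y

/-- The product of two reflections. -/
def reflPair (u v : Fin n → ℝ) (hu : u ≠ 0) (hv : v ≠ 0) : SO n :=
  ⟨reflMatrix u * reflMatrix v, mul_mem (reflMatrix_mem u) (reflMatrix_mem v), by
    change (reflMatrix u * reflMatrix v).det = 1
    rw [det_mul, det_reflMatrix hu, det_reflMatrix hv]
    norm_num⟩

theorem continuous_reflPair {Y : Type*} [TopologicalSpace Y] {f g : Y → Fin n → ℝ}
    (hf : Continuous f) (hg : Continuous g) (hf0 : ∀ y, f y ≠ 0) (hg0 : ∀ y, g y ≠ 0) :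
    Continuous fun y => reflPair (f y) (g y) (hf0 y) (hg0 y) :=
  Continuous.subtype_mk
    ((continuous_reflMatrix hf hf0).matrix_mul (continuous_reflMatrix hg hg0)) _

theorem reflPair_congr {u v u' v' : Fin n → ℝ} (hu : u ≠ 0) (hv : v ≠ 0) (hu' : u' ≠ 0)
    (hv' : v' ≠ 0) (h : u = u') (h' : v = v') : reflPair u v hu hv = reflPair u' v' hu' hv' := by
  subst h h'
  rfl

theorem reflPair_eq_one {u v : Fin n → ℝ} (hu : u ≠ 0) (hv : v ≠ 0) (h : u = v) :
    reflPair u v hu hv = 1 := by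
  subst h
  exact Subtype.ext (reflMatrix_mul_self u)

theorem reflPair_mulVec_of_orthogonal {u v x : Fin n → ℝ} (hu : u ≠ 0) (hv : v ≠ 0)
    (hux : u ⬝ᵥ x = 0) (hvx : v ⬝ᵥ x = 0) : (reflPair u v hu hv).1 *ᵥ x = x := by
  rw [reflPair, ← mulVec_mulVec, reflMatrix_mulVec_of_orthogonal hvx,
    reflMatrix_mulVec_of_orthogonal hux]

/-- Reflection along `c` sends `c` to `-c`; since `c` and `d` are unit vectors, reflection along `c
+ d` sends `-c` to `d`. -/
theorem reflPair_mulVec {c d u : Fin n → ℝ} (hc : c ⬝ᵥ c = 1) (hd : d ⬝ᵥ d = 1)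
    (hcd : u ≠ 0) (hc0 : c ≠ 0) (hu : u = c + d) : (reflPair u c hcd hc0).1 *ᵥ c = d := by
  subst hu
  have h0 : (c + d) ⬝ᵥ (c + d) ≠ 0 := dotProduct_self_eq_zero.not.2 hcd
  have h1 : reflMatrix c *ᵥ c = -c := by
    rw [reflMatrix_mulVec, hc]
    module
  have h2 : (c + d) ⬝ᵥ (c + d) = 2 * ((c + d) ⬝ᵥ c) := by
    simp only [add_dotProduct, dotProduct_add, hc, hd, dotProduct_comm d c]
    ring
  rw [reflPair, ← mulVec_mulVec, h1, reflMatrix_mulVec, dotProduct_neg]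
  have h3 : 2 / ((c + d) ⬝ᵥ (c + d)) * -((c + d) ⬝ᵥ c) = -1 := by
    rw [h2] at h0 ⊢
    have h4 : (c + d) ⬝ᵥ c ≠ 0 := right_ne_zero_of_mul h0
    generalize (c + d) ⬝ᵥ c = x at h4 ⊢
    field_simp
  rw [h3]
  module

theorem inv_mulVec_eq_of_mulVec_eq {A : SO n} {v w : Fin n → ℝ} (h : A.1 *ᵥ v = w) :
    (A⁻¹).1 *ᵥ w = v := by
  rw [← h, mulVec_mulVec, ← Submonoid.coe_mul, inv_mul_cancel]
  exact one_mulVec v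

/-- If the unit vectors `c t` and `d t` are never antipodal, then there are rotations that take
`c t` to `d t`, depend continuously on `t` and contract continuously to the identity. -/
theorem exists_rotation_family (c d : I → Fin n → ℝ) (hcc : Continuous c) (hdc : Continuous d)
    (hc : ∀ t, c t ⬝ᵥ c t = 1) (hd : ∀ t, d t ⬝ᵥ d t = 1) (hne : ∀ t, d t ≠ -c t)
    (hc01 : c 0 = c 1) (hd01 : d 0 = d 1) :
    ∃ W : I × I → SO n, Continuous W ∧ (∀ s, W (s, 1) = W (s, 0)) ∧ (∀ t, W (0, t) = 1) ∧
      (∀ t, (W (1, t)).1 *ᵥ c t = d t) ∧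
      ∀ t w, c t ⬝ᵥ w = 0 → d t ⬝ᵥ w = 0 → (W (1, t)).1 *ᵥ w = w := by
  have hc0 : ∀ t, c t ≠ 0 := fun t ht => by simpa [ht] using hc t
  -- Comparing lengths, the sum can vanish only for `s = 1`, and then `d t` is antipodal to `c t`.
  have hsum : ∀ s t : I, c t + s.1 • d t ≠ 0 := by
    intro s t hst
    have e1 : c t = -(s.1 • d t) := eq_neg_of_add_eq_zero_left hst
    have e2 : s.1 * s.1 = 1 := by
      have := hc t
      rw [e1] at this
      simpa [hd] using this
    have e3 : s.1 = 1 := (mul_self_eq_one_iff.1 e2).resolve_right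
      fun h => absurd (unitInterval.nonneg s) (by rw [h]; norm_num)
    rw [e3, one_smul] at e1
    exact hne t (by rw [e1, neg_neg])
  have hcs : Continuous fun p : I × I => c p.2 := hcc.comp continuous_snd
  have hf : Continuous fun p : I × I => c p.2 + p.1.1 • d p.2 :=
    hcs.add ((continuous_subtype_val.comp continuous_fst).smul (hdc.comp continuous_snd))
  refine ⟨fun p => reflPair (c p.2 + p.1.1 • d p.2) (c p.2) (hsum p.1 p.2) (hc0 p.2),
    continuous_reflPair hf hcs (fun p => hsum p.1 p.2) fun p => hc0 p.2,
    fun s => ?_, fun t => ?_, fun t => ?_, fun t w h1 h2 => ?_⟩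
  · exact reflPair_congr _ _ _ _ (by rw [hc01, hd01]) hc01.symm
  · exact reflPair_eq_one _ _ (by rw [Set.Icc.coe_zero, zero_smul, add_zero])
  · exact reflPair_mulVec (hc t) (hd t) _ _ (by rw [Set.Icc.coe_one, one_smul])
  · exact reflPair_mulVec_of_orthogonal _ _ (by simp [h1, h2]) h1

/-- A loop `α` in `SO_n` can be deformed so that the orbit of a unit vector `e` becomes any
prescribed loop in the sphere that is nowhere antipodal to `t ↦ α(t) e`, up to a fixed rotation.
The deformation takes place in the plane spanned by the two loops. -/
theorem exists_loop_of_ne_neg (α : C(I, SO n)) (h0 : α 0 = 1) (h1 : α 1 = 1) {e : Fin n → ℝ}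
    (he : e ⬝ᵥ e = 1) (d : I → Fin n → ℝ) (hdc : Continuous d) (hd : ∀ t, d t ⬝ᵥ d t = 1)
    (hd01 : d 0 = d 1) (hne : ∀ t, d t ≠ -((α t).1 *ᵥ e)) :
    ∃ β : C(I, SO n), β 0 = 1 ∧ β 1 = 1 ∧ pathClass β = pathClass α ∧
      ∃ B : SO n, (∀ t, (β t).1 *ᵥ e = B.1 *ᵥ d t) ∧
        ∀ w, w ⬝ᵥ e = 0 → (∀ t, d t ⬝ᵥ w = 0) → (∀ t, (α t).1 *ᵥ w = w) →
          (∀ t, (β t).1 *ᵥ w = w) ∧ B.1 *ᵥ w = w := by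
  obtain ⟨W, hW, hW01, hW0, hW1, hWfix⟩ := exists_rotation_family (fun t => (α t).1 *ᵥ e) d
    ((continuous_subtype_val.comp α.continuous).matrix_mulVec continuous_const) hdc
    (fun t => by rw [mulVec_dotProduct_mulVec, he]) hd hne (by rw [h0, h1]) hd01
  -- The left factor rebases every stage at the identity; its value at the end of the deformation is
  -- the fixed rotation `B`.
  have hK : Continuous fun p : I × I => (W (p.1, 0))⁻¹ * W p * α p.2 := by fun_prop
  have hmul : ∀ t x, ((W (1, 0))⁻¹ * W (1, t) * α t).1 *ᵥ x =
      (W (1, 0))⁻¹.1 *ᵥ ((W (1, t)).1 *ᵥ ((α t).1 *ᵥ x)) := fun t x => by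
    rw [Submonoid.coe_mul, Submonoid.coe_mul, mulVec_mulVec, mulVec_mulVec, mul_assoc]
  refine ⟨⟨fun t => (W (1, 0))⁻¹ * W (1, t) * α t, by fun_prop⟩, ?_, ?_, ?_, (W (1, 0))⁻¹,
    ?_, ?_⟩
  · simp [h0]
  · simp [h1, hW01]
  · symm
    refine pathClass_eq_of_homotopy _ hK ?_ (fun t => rfl) ?_ ?_ <;> intro t <;>
      simp [hW0, h0, h1, hW01]
  · intro t
    rw [ContinuousMap.coe_mk, hmul, hW1]
  · intro w hwe hwd hwα
    have hWw : ∀ t, (W (1, t)).1 *ᵥ w = w := fun t => hWfix t w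
      (by
        have h2 := mulVec_dotProduct_mulVec (α t) e w
        rw [hwα t] at h2
        rw [h2, dotProduct_comm, hwe]) (hwd t)
    refine ⟨fun t => ?_, inv_mulVec_eq_of_mulVec_eq (hWw 0)⟩
    rw [ContinuousMap.coe_mk, hmul, hwα, hWw, inv_mulVec_eq_of_mulVec_eq (hWw 0)]

end TurnVector

/-! ### Smooth approximation and general position -/

section Approximation

/-- Smooth approximation of a function on the unit interval, exact at the end points. -/
theorem exists_contDiff_near (f : C(I, ℝ)) {ε : ℝ} (hε : 0 < ε) :
    ∃ q : ℝ → ℝ, ContDiff ℝ 1 q ∧ q 0 = f 0 ∧ q 1 = f 1 ∧ (∀ t : I, |q t - f t| < ε) ∧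
      (f = 0 → q = 0) := by
  -- The zero function is treated separately so that coordinates that vanish identically keep doing
  -- so.
  by_cases hf : f = 0
  · exact ⟨0, contDiff_const, by simp [hf], by simp [hf], by simp [hf, hε], fun _ => rfl⟩
  obtain ⟨p, hp⟩ := exists_polynomial_near_continuousMap 0 1 f (ε / 2) (by positivity)
  rw [ContinuousMap.norm_lt_iff _ (by positivity)] at hp
  have hp' : ∀ t : I, |p.eval t.1 - f t| < ε / 2 := fun t => hp t
  -- Linear interpolation of the two end point errors makes the Weierstrass approximation exact
  -- there and costs at most another `ε / 2`.
  refine ⟨fun x => p.eval x + ((1 - x) * (f 0 - p.eval 0) + x * (f 1 - p.eval 1)), ?_, by simp,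
    by simp, ?_, fun h => absurd h hf⟩
  · have : ContDiff ℝ 1 fun x : ℝ => p.eval x := by
      simpa using p.contDiff_aeval (𝕜 := ℝ) 1
    fun_prop
  · intro t
    have h0 := abs_lt.1 (hp' 0)
    have h1 := abs_lt.1 (hp' 1)
    have ht := abs_lt.1 (hp' t)
    have hc : |(1 - t.1) * (f 0 - p.eval 0) + t.1 * (f 1 - p.eval 1)| ≤ ε / 2 := by
      have t0 := t.2.1
      have t1 := t.2.2
      simp only [Set.Icc.coe_zero, Set.Icc.coe_one] at h0 h1
      rw [abs_le]
      constructor <;> nlinarith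
    have hc' := abs_le.1 hc
    rw [abs_lt]
    constructor <;> linarith

/-- Smooth approximation of a curve, exact at the end points. -/
theorem exists_contDiff_near_pi {n : ℕ} (c : C(I, Fin n → ℝ)) {ε : ℝ} (hε : 0 < ε) :
    ∃ p : ℝ → Fin n → ℝ, ContDiff ℝ 1 p ∧ p 0 = c 0 ∧ p 1 = c 1 ∧
      (∀ (t : I) (j), |p t j - c t j| < ε) ∧ ∀ j, (∀ t, c t j = 0) → ∀ x, p x j = 0 := by
  choose q h1 h2 h3 h4 h5 using fun j : Fin n =>
    exists_contDiff_near (⟨fun t => c t j, by fun_prop⟩ : C(I, ℝ)) hε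
  refine ⟨fun x j => q j x, contDiff_pi.2 h1, funext h2, funext h3, fun t j => h4 j t,
    fun j hj x => ?_⟩
  exact congrFun (h5 j (ContinuousMap.ext hj)) x

/-- The cone over a smooth curve in `ℝᵐ⁺¹`, `m ≥ 2`, is not everything. -/
theorem exists_notMem_cone {n m : ℕ} (hm : 2 ≤ m) (hmn : m < n) {p : ℝ → Fin n → ℝ}
    (hp : ContDiff ℝ 1 p) :
    ∃ v : Fin n → ℝ, (∀ j, m < j.1 → v j = 0) ∧ ∀ s x : ℝ, s • p x ≠ v := by
  -- The cone, projected to the first `m + 1` coordinates, is a `C¹` image of the plane. Since `2 <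
  -- m + 1`, its complement is dense.
  have hF : ContDiff ℝ 1 fun y : ℝ × ℝ => fun i : Fin (m + 1) =>
      y.1 * p y.2 (Fin.castLE hmn i) := by
    refine contDiff_pi.2 fun i => contDiff_fst.mul ?_
    exact (contDiff_pi.1 hp _).comp contDiff_snd
  have hdense := hF.dense_compl_range_of_finrank_lt_finrank (by simp; omega)
  obtain ⟨v, hv⟩ := hdense.nonempty
  refine ⟨fun j => if h : j.1 < m + 1 then v ⟨j.1, h⟩ else 0, fun j hj => dif_neg (by omega), ?_⟩
  intro s x hsx
  refine hv ⟨(s, x), funext fun i => ?_⟩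
  have := congrFun hsx (Fin.castLE hmn i)
  simpa [Nat.lt_succ_iff.1 i.2] using this

end Approximation

/-! ### Pushing loops into `SO_2`, and the generator of the fundamental group -/

section LoopReduction

open Matrix

variable {n : ℕ}

/-- The product differs from `1` by at most `n / (n + 1)`. Positivity ensures that an approximating
curve can be normalised and is never antipodal to the original. -/
theorem dotProduct_pos_of_near {c p : Fin n → ℝ} (hc : c ⬝ᵥ c = 1)
    (h : ∀ j, |p j - c j| < 1 / (n + 1)) : 0 < p ⬝ᵥ c := by
  have hcj : ∀ j, |c j| ≤ 1 := fun j => by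
    rw [← sq_le_one_iff_abs_le_one, sq, ← hc]
    exact Finset.single_le_sum (f := fun j => c j * c j) (fun i _ => mul_self_nonneg _)
      (Finset.mem_univ j)
  have h1 : p ⬝ᵥ c = 1 + ∑ j, (p j - c j) * c j := by
    rw [← hc, dotProduct, dotProduct, ← Finset.sum_add_distrib]
    exact Finset.sum_congr rfl fun j _ => by ring
  have h2 : |∑ j, (p j - c j) * c j| ≤ n * (1 / (n + 1)) := by
    refine (Finset.abs_sum_le_sum_abs _ _).trans ?_
    refine (Finset.sum_le_card_nsmul _ _ (1 / (n + 1 : ℝ)) fun j _ => ?_).trans (by simp)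
    rw [abs_mul]
    have := mul_le_mul (h j).le (hcj j) (abs_nonneg _) (by positivity)
    simpa using this
  have h3 : (n : ℝ) * (1 / (n + 1)) < 1 := by
    rw [mul_one_div, div_lt_one (by positivity)]
    linarith
  have := (abs_le.1 h2).1
  linarith

theorem normalize_dotProduct_self {v : Fin n → ℝ} (hv : v ≠ 0) :
    ((√(v ⬝ᵥ v))⁻¹ • v) ⬝ᵥ ((√(v ⬝ᵥ v))⁻¹ • v) = 1 := by
  have h0 : 0 < v ⬝ᵥ v := by
    have := dotProduct_self_star_nonneg v
    simp only [star_trivial] at this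
    exact this.lt_of_ne' (by simpa using hv)
  have h1 := Real.sq_sqrt h0.le
  have h2 : √(v ⬝ᵥ v) ≠ 0 := (Real.sqrt_pos.2 h0).ne'
  rw [smul_dotProduct, dotProduct_smul, smul_eq_mul, smul_eq_mul]
  field_simp
  exact h1.symm

/-- A loop in `SO_{m+1} ⊆ SO_n` can be deformed into `SO_m` if `m ≥ 2`. -/
theorem exists_loop_fixing {m : ℕ} (hm : 2 ≤ m) (hmn : m < n) (α : C(I, SO n)) (h0 : α 0 = 1)
    (h1 : α 1 = 1) (hα : ∀ t, ∀ j : Fin n, m < j.1 → (α t).1 *ᵥ stdVec j = stdVec j) :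
    ∃ β : C(I, SO n), β 0 = 1 ∧ β 1 = 1 ∧ pathClass β = pathClass α ∧
      ∀ t, ∀ j : Fin n, m ≤ j.1 → (β t).1 *ᵥ stdVec j = stdVec j := by
  let e : Fin n → ℝ := stdVec ⟨m, hmn⟩
  have he : e ⬝ᵥ e = 1 := by simp [e]
  have hje : ∀ j : Fin n, m < j.1 → stdVec j ⬝ᵥ e = 0 := fun j hj => by
    have : (⟨m, hmn⟩ : Fin n) ≠ j := fun h => by simp [← h] at hj
    simp [e, this.symm]
  let c : C(I, Fin n → ℝ) := ⟨fun t => (α t).1 *ᵥ e,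
    (continuous_subtype_val.comp α.continuous).matrix_mulVec continuous_const⟩
  have hc : ∀ t, c t ⬝ᵥ c t = 1 := fun t => by
    change ((α t).1 *ᵥ e) ⬝ᵥ ((α t).1 *ᵥ e) = 1
    rw [mulVec_dotProduct_mulVec, he]
  have hcj : ∀ j : Fin n, m < j.1 → ∀ t, c t j = 0 := fun j hj t => by
    have : stdVec j ⬝ᵥ c t = 0 := by
      change stdVec j ⬝ᵥ ((α t).1 *ᵥ e) = 0
      rw [← hα t j hj, mulVec_dotProduct_mulVec, hje j hj]
    simpa using this
  obtain ⟨p, hp, hp0, hp1, hpc, hpj⟩ :=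
    exists_contDiff_near_pi c (ε := 1 / (n + 1)) (by positivity)
  have hpos : ∀ t : I, 0 < p t ⬝ᵥ c t := fun t => dotProduct_pos_of_near (hc t) (hpc t)
  have hpne : ∀ t : I, p t ≠ 0 := fun t ht => by simpa [ht] using hpos t
  have hpp : ∀ t : I, 0 < √(p t ⬝ᵥ p t) := fun t => by
    have h := dotProduct_self_star_nonneg (p t)
    simp only [star_trivial] at h
    exact Real.sqrt_pos.2 (h.lt_of_ne' (by simpa using hpne t))
  let d : I → Fin n → ℝ := fun t => (√(p t ⬝ᵥ p t))⁻¹ • p t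
  have hpI : Continuous fun t : I => p t := hp.continuous.comp continuous_subtype_val
  have hdc : Continuous d :=
    ((Real.continuous_sqrt.comp (hpI.dotProduct hpI)).inv₀ fun t => (hpp t).ne').smul hpI
  have hc01 : c 0 = c 1 := by
    change (α 0).1 *ᵥ e = (α 1).1 *ᵥ e
    rw [h0, h1]
  have hd01 : d 0 = d 1 := by
    have : p (0 : I) = p (1 : I) := by
      rw [Set.Icc.coe_zero, Set.Icc.coe_one, hp0, hp1, hc01]
    simp only [d, this]
  have hdj : ∀ j : Fin n, m < j.1 → ∀ t, d t ⬝ᵥ stdVec j = 0 := fun j hj t => by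
    simp [d, hpj j (hcj j hj)]
  -- First deformation: up to the rotation `B`, the orbit of `e` becomes the normalised smooth curve
  -- `d`.
  obtain ⟨β, hβ0, hβ1, hβα, B, hβe, hβfix⟩ := exists_loop_of_ne_neg α h0 h1 he d hdc
    (fun t => normalize_dotProduct_self (hpne t)) hd01 (fun t ht => by
      have h2 : d t ⬝ᵥ c t = -1 := by
        rw [ht]
        change -(c t) ⬝ᵥ c t = -1
        rw [neg_dotProduct, hc]
      have h3 : 0 < d t ⬝ᵥ c t := by
        rw [smul_dotProduct, smul_eq_mul]
        exact mul_pos (inv_pos.2 (hpp t)) (hpos t)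
      linarith)
  have hβj : ∀ j : Fin n, m < j.1 → (∀ t, (β t).1 *ᵥ stdVec j = stdVec j) ∧
      B.1 *ᵥ stdVec j = stdVec j := fun j hj =>
    hβfix _ (hje j hj) (hdj j hj) fun t => hα t j hj
  obtain ⟨v, hvj, hv⟩ := exists_notMem_cone hm hmn hp
  have hv0 : v ≠ 0 := fun h => hv 0 0 (by simp [h])
  let w : Fin n → ℝ := (√(v ⬝ᵥ v))⁻¹ • v
  have hw : w ⬝ᵥ w = 1 := normalize_dotProduct_self hv0
  -- Second deformation: the direction `w` lies off the cone over `p`, so it is never `d t`, and the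
  -- constant `-(B w)` is never antipodal to the orbit `B (d t)`. The orbit of `e` can therefore be
  -- made constant.
  obtain ⟨β', hβ'0, hβ'1, hβ'β, B', hβ'e, hβ'fix⟩ := exists_loop_of_ne_neg β hβ0 hβ1 he
    (fun _ => -(B.1 *ᵥ w)) continuous_const
    (fun t => by simpa [mulVec_dotProduct_mulVec] using hw) rfl
    (fun t ht => by
      rw [hβe t, neg_inj] at ht
      have h2 : w = d t := by
        have := congrArg (fun x => (B⁻¹).1 *ᵥ x) ht
        simpa only [inv_mulVec_eq_of_mulVec_eq (A := B) rfl] using this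
      have h3 : √(v ⬝ᵥ v) ≠ 0 := fun h => by
        have := hw
        simp [w, h] at this
      refine hv (√(v ⬝ᵥ v) * (√(p t ⬝ᵥ p t))⁻¹) t ?_
      have h4 : v = √(v ⬝ᵥ v) • w := by simp only [w, smul_smul, mul_inv_cancel₀ h3, one_smul]
      rw [mul_smul]
      change √(v ⬝ᵥ v) • d t = v
      rw [← h2, ← h4])
  have hwj : ∀ j : Fin n, m < j.1 → w ⬝ᵥ stdVec j = 0 := fun j hj => by simp [w, hvj j hj]
  refine ⟨β', hβ'0, hβ'1, hβ'β.trans hβα, fun t j hj => ?_⟩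
  rcases hj.eq_or_lt with hj | hj
  · obtain rfl : j = ⟨m, hmn⟩ := Fin.ext hj.symm
    -- The constant orbit starts at `e`, so `e` is fixed throughout.
    have h2 := hβ'e 0
    rw [hβ'0] at h2
    change (β' t).1 *ᵥ e = e
    rw [hβ'e t, ← h2]
    exact one_mulVec e
  · refine (hβ'fix _ (hje j hj) (fun _ => ?_) (hβj j hj).1).1 t
    rw [neg_dotProduct, neg_eq_zero]
    nth_rewrite 1 [← (hβj j hj).2]
    rw [mulVec_dotProduct_mulVec, hwj j hj]

/-- Every loop in `SO_n` can be deformed into `SO_2`. -/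
theorem exists_loop_in_SO_two (α : C(I, SO n)) (h0 : α 0 = 1) (h1 : α 1 = 1) :
    ∃ β : C(I, SO n), β 0 = 1 ∧ β 1 = 1 ∧ pathClass β = pathClass α ∧
      ∀ t, ∀ j : Fin n, 2 ≤ j.1 → (β t).1 *ᵥ stdVec j = stdVec j := by
  -- Descending induction from `SO_n`, removing one dimension at a time.
  have key : ∀ i, 2 ≤ n - i → ∃ β : C(I, SO n), β 0 = 1 ∧ β 1 = 1 ∧
      pathClass β = pathClass α ∧
      ∀ t, ∀ j : Fin n, n - i ≤ j.1 → (β t).1 *ᵥ stdVec j = stdVec j := by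
    intro i
    induction i with
    | zero => exact fun _ => ⟨α, h0, h1, rfl, fun t j hj => absurd j.2 (by omega)⟩
    | succ i ih =>
      intro hi
      obtain ⟨β, hβ0, hβ1, hβα, hβ⟩ := ih (by omega)
      obtain ⟨β', hβ'0, hβ'1, hβ'β, hβ'⟩ := exists_loop_fixing (m := n - (i + 1)) hi (by omega) β
        hβ0 hβ1 fun t j hj => hβ t j (by omega)
      exact ⟨β', hβ'0, hβ'1, hβ'β.trans hβα, hβ'⟩
  rcases le_or_gt 2 n with hn | hn
  · obtain ⟨β, hβ0, hβ1, hβα, hβ⟩ := key (n - 2) (by omega)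
    exact ⟨β, hβ0, hβ1, hβα, fun t j hj => hβ t j (by omega)⟩
  · exact ⟨α, h0, h1, rfl, fun t j hj => absurd j.2 (by omega)⟩

/-- A special orthogonal matrix that fixes all but one basis vectors is the identity. -/
theorem eq_one_of_fixing {A : SO n} (i : Fin n) (h : ∀ j, j ≠ i → A.1 *ᵥ stdVec j = stdVec j) :
    A = 1 := by
  have hcol : ∀ j, j ≠ i → ∀ l, A.1 l j = stdVec j l := fun j hj l => by
    rw [← h j hj]
    simp
  -- Column `i` is orthogonal to the other columns, which are basis vectors. So the matrix is
  -- diagonal, and the determinant fixes the last entry.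
  have hi : ∀ l, l ≠ i → A.1 l i = 0 := fun l hl => by
    have h2 := mulVec_dotProduct_mulVec A (stdVec l) (stdVec i)
    rw [h l hl] at h2
    simpa [hl] using h2
  have hdiag : A.1 = diagonal fun j => A.1 j j := by
    ext l j
    by_cases hj : j = i
    · subst hj
      by_cases hl : l = j
      · simp [hl]
      · rw [hi l hl, diagonal_apply_ne _ hl]
    · by_cases hl : l = j
      · simp [hl]
      · rw [hcol j hj, diagonal_apply_ne _ hl]
        simp [hl]
  have hii : A.1 i i = 1 := by
    have hdet : A.1.det = 1 := A.2.2
    rw [hdiag, det_diagonal, Finset.prod_eq_single i (fun j _ hj => by simp [hcol j hj j])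
      (by simp)] at hdet
    exact hdet
  apply Subtype.ext
  rw [hdiag]
  change _ = (1 : Matrix (Fin n) (Fin n) ℝ)
  rw [← diagonal_one]
  congr 1
  ext j
  by_cases hj : j = i
  · rw [hj, hii]
  · simp [hcol j hj j]

theorem rot_intCast_mul {e f : Fin n → ℝ} (h : IsOrthoPair e f) (z : ℤ) (θ : ℝ) :
    rot h (z * θ) = rot h θ ^ z := by
  let φ : Multiplicative ℝ →* SO n :=
    { toFun := fun x => rot h x.toAdd
      map_one' := rot_zero h
      map_mul' := fun x y => rot_add h _ _ }
  have := map_zpow φ (Multiplicative.ofAdd θ) z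
  simpa [φ] using this

/-- Every loop in `SO_2 ⊆ SO_n` is homotopic to a power of the full rotation. -/
theorem pathClass_eq_zpow_of_fixing (hn : 2 ≤ n)
    (h : IsOrthoPair (stdVec (⟨0, by omega⟩ : Fin n)) (stdVec ⟨1, by omega⟩))
    (α : C(I, SO n)) (h0 : α 0 = 1) (h1 : α 1 = 1)
    (hα : ∀ t, ∀ j : Fin n, 2 ≤ j.1 → (α t).1 *ᵥ stdVec j = stdVec j) :
    ∃ z : ℤ, pathClass α = pathClass (rotLoop h) ^ z := by
  set i₀ : Fin n := ⟨0, by omega⟩ with hi₀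
  set i₁ : Fin n := ⟨1, by omega⟩ with hi₁
  have h01 : i₀ ≠ i₁ := by simp [hi₀, hi₁]
  let c : C(I, Fin n → ℝ) := ⟨fun t => (α t).1 *ᵥ stdVec i₀,
    (continuous_subtype_val.comp α.continuous).matrix_mulVec continuous_const⟩
  have hcj : ∀ t, ∀ j, j ≠ i₀ → j ≠ i₁ → c t j = 0 := fun t j hj0 hj1 => by
    have hj2 : 2 ≤ j.1 := by
      have e0 : j.1 ≠ 0 := fun hh => hj0 (Fin.ext hh)
      have e1 : j.1 ≠ 1 := fun hh => hj1 (Fin.ext hh)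
      omega
    have : stdVec j ⬝ᵥ c t = 0 := by
      change stdVec j ⬝ᵥ ((α t).1 *ᵥ stdVec i₀) = 0
      rw [← hα t j hj2, mulVec_dotProduct_mulVec]
      simp [hj0]
    simpa using this
  have hceq : ∀ t, c t = c t i₀ • stdVec i₀ + c t i₁ • stdVec i₁ := fun t => by
    ext j
    by_cases hj0 : j = i₀
    · simp [hj0, h01]
    · by_cases hj1 : j = i₁
      · simp [hj1, h01.symm]
      · simp [hcj t j hj0 hj1, hj0, hj1]
  have hnorm : ∀ t, c t i₀ * c t i₀ + c t i₁ * c t i₁ = 1 := fun t => by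
    have e1 : c t ⬝ᵥ c t = 1 := by
      change ((α t).1 *ᵥ stdVec i₀) ⬝ᵥ ((α t).1 *ᵥ stdVec i₀) = 1
      rw [mulVec_dotProduct_mulVec, h.1]
    rw [← e1]
    conv_rhs => rw [hceq t]
    simp [h01, h01.symm]
  -- The orbit of the first basis vector, read as a path in the circle, is lifted below to a
  -- continuous angle `Θ`.
  let ζ : C(I, Circle) := ⟨fun t => ⟨c t i₀ + c t i₁ * Complex.I, by
      rw [Submonoid.unitSphere, Submonoid.mem_mk, Subsemigroup.mem_mk, mem_sphere_zero_iff_norm,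
        ← sq_eq_sq₀ (norm_nonneg _) zero_le_one, Complex.sq_norm, Complex.normSq_apply]
      simpa using hnorm t⟩, by
      refine Continuous.subtype_mk ?_ _
      fun_prop⟩
  have hc0 : c 0 = stdVec i₀ := by
    change (α 0).1 *ᵥ stdVec i₀ = _
    rw [h0]
    exact one_mulVec _
  obtain ⟨Θ, hΘ, hΘ0⟩ := Circle.isCoveringMap_exp.exists_path_lifts ζ 0 (by
    rw [Circle.exp_zero]
    apply Subtype.ext
    change ((c 0 i₀ : ℂ) + c 0 i₁ * Complex.I) = 1
    rw [hc0]
    simp [h01.symm])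
  have hexp : ∀ t, Complex.exp (Θ t * Complex.I) = c t i₀ + c t i₁ * Complex.I := fun t =>
    congrArg Subtype.val (congrFun hΘ t)
  have hcos : ∀ t, Real.cos (Θ t) = c t i₀ := fun t => by
    have := congrArg Complex.re (hexp t)
    simpa [Complex.exp_ofReal_mul_I_re] using this
  have hsin : ∀ t, Real.sin (Θ t) = c t i₁ := fun t => by
    have := congrArg Complex.im (hexp t)
    simpa [Complex.exp_ofReal_mul_I_im] using this
  have hrot : ∀ t, α t = rot h (Θ t) := fun t => by
    symm
    rw [← inv_mul_eq_one]
    -- It suffices to compare `α t` with the rotation on all basis vectors but the second, since the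
    -- determinant settles that one.
    refine eq_one_of_fixing i₁ fun j hj => ?_
    rw [Submonoid.coe_mul, ← mulVec_mulVec]
    apply inv_mulVec_eq_of_mulVec_eq
    by_cases hj0 : j = i₀
    · subst hj0
      change _ = c t
      rw [hceq t, ← hcos, ← hsin]
      simp only [rot_mulVec, h.1, show stdVec i₁ ⬝ᵥ stdVec i₀ = 0 by simp [h01]]
      module
    · rw [hα t j (by
        have e0 : j.1 ≠ 0 := fun hh => hj0 (Fin.ext hh)
        have e1 : j.1 ≠ 1 := fun hh => hj (Fin.ext hh)
        omega)]
      exact rot_mulVec_of_orthogonal h _ (by simp [Ne.symm hj0]) (by simp [Ne.symm hj])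
  have hc1 : c 1 = stdVec i₀ := by
    change (α 1).1 *ᵥ stdVec i₀ = _
    rw [h1]
    exact one_mulVec _
  obtain ⟨z, hz⟩ : ∃ z : ℤ, (z : ℝ) * (2 * Real.pi) = Θ 1 := by
    rw [← Real.cos_eq_one_iff, hcos, hc1]
    simp
  refine ⟨z, ?_⟩
  rw [← map_zpow]
  -- Interpolate linearly between `Θ` and the uniform angle with the same end values `0` and `z * (2
  -- * π)`, where `z` is the winding number.
  refine pathClass_eq_of_homotopy
    (fun p => rot h ((1 - p.1.1) * Θ p.2 + p.1.1 * (z * (2 * Real.pi * p.2))))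
    (by fun_prop) ?_ ?_ ?_ ?_
  · intro t
    simp [hrot]
  · intro t
    simp [rotLoop_apply, rot_intCast_mul]
  · intro s
    simp [hΘ0, rot_zero, h0]
  · intro s
    rw [h1, ← hz, Set.Icc.coe_one, mul_one, ← add_mul, sub_add_cancel, one_mul, rot_intCast_mul,
      rot_two_pi, _root_.one_zpow]

/-- `π₁(SO_n)` is generated by the full rotation. -/
theorem pathClass_loop_eq_zpow (hn : 2 ≤ n)
    (h : IsOrthoPair (stdVec (⟨0, by omega⟩ : Fin n)) (stdVec ⟨1, by omega⟩))
    (α : C(I, SO n)) (h0 : α 0 = 1) (h1 : α 1 = 1) :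
    ∃ z : ℤ, pathClass α = pathClass (rotLoop h) ^ z := by
  obtain ⟨β, hβ0, hβ1, hβα, hβ⟩ := exists_loop_in_SO_two α h0 h1
  rw [← hβα]
  exact pathClass_eq_zpow_of_fixing hn h β hβ0 hβ1 hβ

end LoopReduction

/-! ### Loops and paths in the even special orthogonal groups -/

section Even

variable {k : ℕ}

/-- `π₁(SO_{2k})` is generated by a class `r` with `r ^ 2 = 1`, and `r ^ k` is the square of the class
of a path from `1` to `-1`. -/
theorem exists_generator (hk : 1 < k) :
    ∃ r : (pathCon (SO (2 * k))).Quotient, r ^ 2 = 1 ∧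
      (∃ ρ : Path (1 : SO (2 * k)) 1, pathClass ρ.toContinuousMap = r) ∧
      (∀ α : Path (1 : SO (2 * k)) 1, ∃ z : ℤ, pathClass α.toContinuousMap = r ^ z) ∧
      ∃ u : C(I, SO (2 * k)), u 0 = 1 ∧ u 1 = negOne k ∧ pathClass u ^ 2 = r ^ k := by
  have h01 : IsOrthoPair (n := 2 * k) (stdVec ⟨0, by omega⟩) (stdVec ⟨1, by omega⟩) :=
    isOrthoPair_stdVec (by simp)
  -- Since `k > 1`, there is a third coordinate direction, which makes the square of the rotation
  -- class trivial.
  have h12 : IsOrthoPair (n := 2 * k) (stdVec ⟨1, by omega⟩) (stdVec ⟨2, by omega⟩) :=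
    isOrthoPair_stdVec (by simp)
  refine ⟨pathClass (rotLoop h01), pathClass_rotLoop_sq h01 h12 (by simp),
    ⟨⟨rotLoop h01, by simp [rotLoop_apply, rot_zero], by simp [rotLoop_apply, rot_two_pi]⟩, rfl⟩,
    fun α => pathClass_loop_eq_zpow (by omega) h01 _ α.source α.target,
    exists_path_negOne k h01 fun j hj => ?_⟩
  -- The plane with `j = 0` is the reference plane; all the others are orthogonal to it.
  rcases Nat.eq_zero_or_pos j with rfl | hj0
  · rfl
  · refine pathClass_rotLoop_of_orthogonal _ h01 ?_ ?_ ?_ <;>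
      · rw [single_one_dotProduct]
        exact Pi.single_eq_of_ne (by simp only [ne_eq, Fin.mk.injEq]; omega) _

/-- The square of a path from `1` to `-1` is determined by its end points, because loops have order
at most two. -/
theorem pathClass_sq_eq {G : Type*} [TopologicalSpace G] [Group G] [IsTopologicalGroup G]
    (hloop : ∀ α : Path (1 : G) 1, pathClass α.toContinuousMap ^ 2 = 1) {b : G}
    (γ : Path 1 b) (u : C(I, G)) (h0 : u 0 = 1) (h1 : u 1 = b) :
    pathClass γ.toContinuousMap ^ 2 = pathClass u ^ 2 := by
  let α : Path (1 : G) 1 :=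
    { toContinuousMap := γ.toContinuousMap * u⁻¹
      source' := by simp [h0]
      target' := by simp [h1] }
  have hα : pathClass α.toContinuousMap = pathClass γ.toContinuousMap * (pathClass u)⁻¹ := by
    rw [← map_inv, ← map_mul]
  have hγ : pathClass γ.toContinuousMap = pathClass α.toContinuousMap * pathClass u := by
    rw [hα, inv_mul_cancel_right]
  -- The loop class is invariant under conjugation by `u`, so the two commute and the square of the
  -- product splits.
  have hconj := pathClass_conj u α.toContinuousMap h0 α.source α.target
  have hl := hloop α
  generalize pathClass α.toContinuousMap = a at *
  generalize pathClass u = v at *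
  have hcomm : Commute a v := (mul_inv_eq_iff_eq_mul.1 hconj).symm
  rw [hγ, hcomm.mul_pow, hl, one_mul]

/-- The multiplicative relations between the classes of `η`, `γ` and the constant loop. -/
theorem pathClass_relations (hk : 1 < k) (η : Path (1 : SO (2 * k)) 1)
    (hη : Subgroup.zpowers (FundamentalGroup.fromPath (Path.Homotopic.Quotient.mk η)) = ⊤)
    (γ : Path (1 : SO (2 * k)) (negOne k)) :
    pathClass η.toContinuousMap ^ 2 = 1 ∧
      (Even k → pathClass γ.toContinuousMap ^ 2 = 1) ∧
      (Odd k → pathClass γ.toContinuousMap ^ 2 = pathClass η.toContinuousMap) := by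
  obtain ⟨r, hr, ⟨ρ, hρ⟩, hloop, u, hu0, hu1, hu⟩ := exists_generator hk
  have hsq : ∀ α : Path (1 : SO (2 * k)) 1, pathClass α.toContinuousMap ^ 2 = 1 := fun α => by
    obtain ⟨z, hz⟩ := hloop α
    rw [hz, ← zpow_natCast, ← zpow_mul, mul_comm z, zpow_mul, zpow_natCast, hr, one_zpow]
  have hηr : pathClass η.toContinuousMap = r := by
    obtain ⟨z, hz⟩ := hloop η
    -- An odd power of `r` is `r`. If the power is even, `η` is null-homotopic; as it generates, the
    -- fundamental group is then trivial, so `r = 1` too. Nontriviality of the group is thus not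
    -- needed.
    rcases Int.even_or_odd' z with ⟨y, rfl | rfl⟩
    · have h1 : pathClass η.toContinuousMap = 1 := by
        rw [hz, zpow_mul, zpow_ofNat, hr, one_zpow]
      have h2 : η.Homotopic (Path.refl 1) := pathClass_eq_iff.1 h1
      have h3 : FundamentalGroup.fromPath (Path.Homotopic.Quotient.mk η) = 1 := by
        rw [Path.Homotopic.Quotient.eq.2 h2]
        rfl
      rw [h3, Subgroup.zpowers_one_eq_bot] at hη
      have h4 : FundamentalGroup.fromPath (Path.Homotopic.Quotient.mk ρ) ∈
          (⊥ : Subgroup (FundamentalGroup (SO (2 * k)) 1)) := hη ▸ Subgroup.mem_top _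
      have h5 : FundamentalGroup.fromPath (Path.Homotopic.Quotient.mk ρ) =
          FundamentalGroup.fromPath (Path.Homotopic.Quotient.mk η) := by
        rw [h3]
        exact h4
      have h6 : ρ.Homotopic η := Path.Homotopic.Quotient.eq.1 h5
      rw [← hρ]
      exact (pathClass_eq_iff.2 h6).symm
    · rw [hz, zpow_add, zpow_mul, zpow_ofNat, hr, one_zpow, zpow_one, one_mul]
  have hγ := pathClass_sq_eq hsq γ u hu0 hu1
  refine ⟨hsq η, fun hk' => ?_, fun hk' => ?_⟩
  · obtain ⟨m, rfl⟩ := hk'.two_dvd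
    rw [hγ, hu, pow_mul, hr, one_pow]
  · have hpow : ∀ m, Odd m → r ^ m = r := by
      rintro _ ⟨m, rfl⟩
      rw [pow_succ, pow_mul, hr, one_pow, one_mul]
    rw [hγ, hu, hηr, hpow k hk']

end Even

end TurningObstruction

end

/-! ### From relations between path classes to relations between turning obstructions -/

theorem mainTheorem7 {X : Type*} [TopologicalSpace X] (k : ℕ) (hk : 1 < k)
    (η : Path (1 : SO (2 * k)) 1)
    (hη : Subgroup.zpowers (FundamentalGroup.fromPath (Path.Homotopic.Quotient.mk η)) = ⊤)
    (γ : Path (1 : SO (2 * k)) (negOne k))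
    (g : C(X, SO (2 * k))) :
    -- the adjointed turning obstructions, in the group `[SX, SO_{2k}]`
    (2 • TO (one_mem _) (one_mem _) η (HomotopyClasses.mk g) = 0 ∧
      TO (one_mem _) (negOne_mem_center k) (η.trans γ) (HomotopyClasses.mk g) =
        TO (one_mem _) (one_mem _) η (HomotopyClasses.mk g) +
          TO (one_mem _) (negOne_mem_center k) γ (HomotopyClasses.mk g) ∧
      (Even k → 2 • TO (one_mem _) (negOne_mem_center k) γ (HomotopyClasses.mk g) = 0) ∧
      (Odd k →
        2 • TO (one_mem _) (negOne_mem_center k) γ (HomotopyClasses.mk g) =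
            TO (one_mem _) (one_mem _) η (HomotopyClasses.mk g) ∧
          4 • TO (one_mem _) (negOne_mem_center k) γ (HomotopyClasses.mk g) = 0)) ∧
    -- the normalised turning obstructions, in the group `[X, Ω₀ SO_{2k}]`
    (2 • normalisedTurningObs (one_mem _) (one_mem _) η (HomotopyClasses.mk g) = 0 ∧
      normalisedTurningObs (one_mem _) (negOne_mem_center k) (η.trans γ) (HomotopyClasses.mk g) =
        normalisedTurningObs (one_mem _) (one_mem _) η (HomotopyClasses.mk g) +
          normalisedTurningObs (one_mem _) (negOne_mem_center k) γ (HomotopyClasses.mk g) ∧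
      (Even k →
        2 • normalisedTurningObs (one_mem _) (negOne_mem_center k) γ (HomotopyClasses.mk g) = 0) ∧
      (Odd k →
        2 • normalisedTurningObs (one_mem _) (negOne_mem_center k) γ (HomotopyClasses.mk g) =
            normalisedTurningObs (one_mem _) (one_mem _) η (HomotopyClasses.mk g) ∧
          4 • normalisedTurningObs (one_mem _) (negOne_mem_center k) γ
            (HomotopyClasses.mk g) = 0)) := by
  obtain ⟨hη2, heven, hodd⟩ := pathClass_relations hk η hη γ
  have hmulη : pathClass (η.mul η).toContinuousMap = pathClass (Path.refl 1).toContinuousMap := by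
    rw [pathClass_mul, ← sq, hη2, pathClass_refl_one]
  have hmulγ : pathClass (γ.mul γ).toContinuousMap = pathClass γ.toContinuousMap ^ 2 := by
    rw [pathClass_mul, ← sq]
  have htrans : pathClass (η.trans γ).toContinuousMap = pathClass (η.mul γ).toContinuousMap := by
    rw [pathClass_trans, pathClass_mul]
  constructor
  · have h1 : 2 • TO (one_mem _) (one_mem _) η (HomotopyClasses.mk g) = 0 := by
      rw [two_nsmul, TO_add, ← TO_refl_one g]
      exact TO_congr _ _ _ _ g _ _ hmulη
    refine ⟨h1, ?_, fun hk' => ?_, fun hk' => ?_⟩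
    · rw [TO_add]
      exact TO_congr _ _ _ _ g _ _ htrans
    · rw [two_nsmul, TO_add, ← TO_refl_one g]
      exact TO_congr _ _ _ _ g _ _ (by rw [hmulγ, heven hk', pathClass_refl_one])
    · have h2 : 2 • TO (one_mem _) (negOne_mem_center k) γ (HomotopyClasses.mk g) =
          TO (one_mem _) (one_mem _) η (HomotopyClasses.mk g) := by
        rw [two_nsmul, TO_add]
        exact TO_congr _ _ _ _ g _ _ (by rw [hmulγ, hodd hk'])
      exact ⟨h2, by rw [show 4 = 2 * 2 from rfl, mul_nsmul, h2, h1]⟩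
  · have h1 : 2 • normalisedTurningObs (one_mem _) (one_mem _) η (HomotopyClasses.mk g) = 0 := by
      rw [two_nsmul, normalisedTurningObs_add, ← normalisedTurningObs_refl_one g]
      exact normalisedTurningObs_congr _ _ _ _ g _ _ hmulη
    refine ⟨h1, ?_, fun hk' => ?_, fun hk' => ?_⟩
    · rw [normalisedTurningObs_add]
      exact normalisedTurningObs_congr _ _ _ _ g _ _ htrans
    · rw [two_nsmul, normalisedTurningObs_add, ← normalisedTurningObs_refl_one g]
      exact normalisedTurningObs_congr _ _ _ _ g _ _ (by rw [hmulγ, heven hk', pathClass_refl_one])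
    · have h2 : 2 • normalisedTurningObs (one_mem _) (negOne_mem_center k) γ
          (HomotopyClasses.mk g) =
          normalisedTurningObs (one_mem _) (one_mem _) η (HomotopyClasses.mk g) := by
        rw [two_nsmul, normalisedTurningObs_add]
        exact normalisedTurningObs_congr _ _ _ _ g _ _ (by rw [hmulγ, hodd hk'])
      exact ⟨h2, by rw [show 4 = 2 * 2 from rfl, mul_nsmul, h2, h1]⟩
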